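/- Let $\mathbb D$ be the open unit disc and $dA$ the normalized Lebesgue measure on $\mathbb D$. For an arc $I\subset\partial\mathbb D$ of length $|I|\in(0,2\pi]$ let $S(I)=\{re^{it}: e^{it}\in I,\ 1-\frac{|I|}{2\pi}\le r<1\}$. Let $u\in L^1(dA)$ be a weight with $u>0$ a.e. on $\mathbb D$ that satisfies the Bekollé–Bonami condition $B_2$: there is a constant $C$ such that $$\int_{S(I)}u\,dA\int_{S(I)}\frac1u\,dA\le C\,A(S(I))^2\qquad\text{for every arc } I .$$ Put $d\mu=u\,dA$, and let $A^2(u)$ be the space of analytic functions on $\mathbb D$ that lie in $L^2(\mu)$, with the norm and inner product of $L^2(\mu)$. Let $K_u(\cdot,a)\in A^2(u)$, $a\in\mathbb D$, be its reproducing kernels, so that $\langle f,K_u(\cdot,a)\rangle_{A^2(u)}=f(a)$ for all $f\in A^2(u)$, and let $B_a(z)=(1-\bar a z)^{-2}$. Let $\nu$ be a positive Borel measure on $\mathbb D$. The Toeplitz operator $T_\nu$ and the Berezin transform $\tilde\nu$ are given by $$T_\nu f(z)=\int_{\mathbb D}K_u(z,w)f(w)\,d\nu(w),\qquad \tilde\nu(a)=\frac1{\|B_a\|_{A^2(u)}^2}\int_{\mathbb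 D}|B_a(z)|^2\,d\nu(z)\in[0,\infty].$$ For a set $E\subset A^2(u)$, say that $T_\nu$ is compact with core $E$ if, for every $f\in E$, the integral $T_\nu f(z)$ converges absolutely at every $z\in\mathbb D$, and there is a compact operator $T$ on $A^2(u)$ with $Tf=T_\nu f$ for all $f\in E$. Then the following are equivalent: (a) $T_\nu$ is compact with core $E=\{\text{polynomials}\}\cup\{K_u(\cdot,a):a\in\mathbb D\}$; (a$'$) $T_\nu$ is compact with core $E=A^2(u)$, that is, $T_\nu$ is given by its integral formula on all of $A^2(u)$ and is a compact operator on $A^2(u)$; (b) $\tilde\nu(a)\to0$ as $|a|\to1^-$; (c) $\nu$ is a $\mu$-vanishing Carleson measure, that is, the inclusion $A^2(u)\to L^2(\nu)$ is well defined and compact. -/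

import Mathlib

open MeasureTheory Metric Filter Topology
open scoped ENNReal NNReal

namespace BergmanToeplitz

noncomputable section

/-- The open unit disc. -/
abbrev disc : Set ℂ := ball (0 : ℂ) 1

/-- Normalized Lebesgue measure `dA` on the unit disc, as a measure on `ℂ`. -/
def area : Measure ℂ := (ENNReal.ofReal Real.pi)⁻¹ • (volume.restrict disc)

/-- The Carleson square over the arc of the unit circle with midpoint `exp (iθ)` and length `L`,
where `0 < L ≤ 2π`. -/
def carlesonSquare (θ L : ℝ) : Set ℂ :=
  {z | ∃ r t : ℝ, |t - θ| ≤ L / 2 ∧ 1 - L / (2 * Real.pi) ≤ r ∧ r < 1 ∧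
    z = (r : ℂ) * Complex.exp (t * Complex.I)}

/-- Bekollé–Bonami `B₂` weights on the disc: `u` is integrable, positive almost everywhere, and
the product of the averages of `u` and `1 / u` over Carleson squares is bounded. -/
structure IsB2Weight (u : ℂ → ℝ) : Prop where
  integrable : Integrable u area
  pos : ∀ᵐ z ∂area, 0 < u z
  bound : ∃ C : ℝ≥0, ∀ θ L : ℝ, 0 < L → L ≤ 2 * Real.pi →
    (∫⁻ z in carlesonSquare θ L, ENNReal.ofReal (u z) ∂area) *
      (∫⁻ z in carlesonSquare θ L, ENNReal.ofReal (u z)⁻¹ ∂area) ≤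
        C * (area (carlesonSquare θ L)) ^ 2

/-- The measure `dμ = u dA`. -/
def weightMeasure (u : ℂ → ℝ) : Measure ℂ :=
  area.withDensity fun z => ENNReal.ofReal (u z)

/-- The weighted Bergman space `A²(u)`, as the subspace of `L²(u dA)` of those classes that have a
representative analytic on the disc. Its norm and inner product are those of `L²(u dA)`. -/
def bergmanSpace (u : ℂ → ℝ) : Submodule ℂ (Lp ℂ 2 (weightMeasure u)) where
  carrier := {f | ∃ F : ℂ → ℂ, DifferentiableOn ℂ F disc ∧ f =ᵐ[weightMeasure u] F}
  zero_mem' := ⟨0, differentiableOn_const 0, Lp.coeFn_zero _ _ _⟩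
  add_mem' := by
    rintro f g ⟨F, hF, hf⟩ ⟨G, hG, hg⟩
    exact ⟨F + G, hF.add hG, (Lp.coeFn_add f g).trans (hf.add hg)⟩
  smul_mem' := by
    rintro c f ⟨F, hF, hf⟩
    exact ⟨c • F, hF.const_smul c, (Lp.coeFn_smul c f).trans (hf.const_smul c)⟩

/-- The analytic function on the disc represented by an element of `A²(u)`. For a weight that is
positive a.e., its values on the disc are uniquely determined, see `holo_eqOn`; its values outside
the disc are never used. -/
def holo {u : ℂ → ℝ} (f : bergmanSpace u) : ℂ → ℂ := Classical.choose f.2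

theorem holo_differentiableOn {u : ℂ → ℝ} (f : bergmanSpace u) :
    DifferentiableOn ℂ (holo f) disc := (Classical.choose_spec f.2).1

theorem holo_ae_eq {u : ℂ → ℝ} (f : bergmanSpace u) :
    (f : Lp ℂ 2 (weightMeasure u)) =ᵐ[weightMeasure u] holo f := (Classical.choose_spec f.2).2

theorem holo_eqOn {u : ℂ → ℝ} (hu : IsB2Weight u) (f : bergmanSpace u) {F : ℂ → ℂ}
    (hF : DifferentiableOn ℂ F disc)
    (hf : (f : Lp ℂ 2 (weightMeasure u)) =ᵐ[weightMeasure u] F) : Set.EqOn (holo f) F disc := by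
  have h1 : holo f =ᵐ[weightMeasure u] F := (holo_ae_eq f).symm.trans hf
  have hm : AEMeasurable (fun z => ENNReal.ofReal (u z)) area :=
    hu.integrable.aestronglyMeasurable.aemeasurable.ennreal_ofReal
  have h2 : ∀ᵐ z ∂area, holo f z = F z := by
    have h3 := (ae_withDensity_iff' hm).1 h1
    filter_upwards [h3, hu.pos] with z hz hp
    exact hz (by simpa using hp)
  have h4 : holo f =ᵐ[volume.restrict disc] F := by
    have hc : (ENNReal.ofReal Real.pi)⁻¹ ≠ 0 := ENNReal.inv_ne_zero.2 ENNReal.ofReal_ne_top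
    exact (Measure.ae_ennreal_smul_measure_iff hc).1 h2
  exact Measure.eqOn_open_of_ae_eq h4 isOpen_ball
    (holo_differentiableOn f).continuousOn hF.continuousOn

open Classical in
/-- The reproducing kernel `K_u(·, a)`: the element of `A²(u)` with `⟨f, K_u(·, a)⟩ = f(a)` for all
`f` in `A²(u)`. (Mathlib's inner product is conjugate-linear in its first argument.) The default
value is irrelevant: for a `B₂` weight and `a` in the disc such an element exists. -/
def kernel (u : ℂ → ℝ) (a : ℂ) : bergmanSpace u :=
  if h : ∃ K : bergmanSpace u, ∀ f : bergmanSpace u, inner ℂ K f = holo f a then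
    Classical.choose h
  else 0

/-- The reproducing kernel as a function of two variables, `K_u(z, w)`. -/
def K (u : ℂ → ℝ) (z w : ℂ) : ℂ := holo (kernel u w) z

/-- `T` acts on every `f ∈ E` as the Toeplitz integral operator
`T_ν f (z) = ∫ K_u(z, w) f(w) dν(w)`, the integrals being absolutely convergent. -/
def IsToeplitzOn (u : ℂ → ℝ) (ν : Measure ℂ) (E : Set (bergmanSpace u))
    (T : bergmanSpace u →L[ℂ] bergmanSpace u) : Prop :=
  ∀ f ∈ E, ∀ z ∈ disc, Integrable (fun w => K u z w * holo f w) ν ∧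
    holo (T f) z = ∫ w, K u z w * holo f w ∂ν

/-- The Toeplitz operator `T_ν`, given by its integral formula on `E`, is defined there and extends
to a compact operator on `A²(u)`. -/
def ToeplitzCompact (u : ℂ → ℝ) (ν : Measure ℂ) (E : Set (bergmanSpace u)) : Prop :=
  ∃ T : bergmanSpace u →L[ℂ] bergmanSpace u, IsToeplitzOn u ν E T ∧ IsCompactOperator T

/-- The polynomials, as elements of `A²(u)`. -/
def polynomials (u : ℂ → ℝ) : Set (bergmanSpace u) :=
  {f | ∃ p : Polynomial ℂ, (f : Lp ℂ 2 (weightMeasure u)) =ᵐ[weightMeasure u] fun z => p.eval z}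

/-- The reproducing kernels `K_u(·, a)` with `a` in the disc. -/
def kernels (u : ℂ → ℝ) : Set (bergmanSpace u) := kernel u '' disc

/-- The (unweighted) Bergman kernel `B_a(z) = 1 / (1 - \bar a z)²`. -/
def B (a z : ℂ) : ℂ := 1 / (1 - (starRingEnd ℂ) a * z) ^ 2

/-- The Berezin transform `‖B_a‖⁻² ∫ |B_a|² dν`, with the norm of `A²(u)`; it may be infinite. -/
def berezin (u : ℂ → ℝ) (ν : Measure ℂ) (a : ℂ) : ℝ≥0∞ :=
  (∫⁻ z, ‖B a z‖ₑ ^ 2 ∂ν) / (∫⁻ z, ‖B a z‖ₑ ^ 2 ∂(weightMeasure u))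

/-- `ν` is a `u dA`-vanishing Carleson measure: the inclusion `A²(u) → L²(ν)` is (everywhere
defined and) compact. -/
def IsVanishingCarleson (u : ℂ → ℝ) (ν : Measure ℂ) : Prop :=
  ∃ i : bergmanSpace u →L[ℂ] Lp ℂ 2 ν, (∀ f, i f =ᵐ[ν] holo f) ∧ IsCompactOperator i

end

end BergmanToeplitz

namespace BergmanToeplitz

noncomputable section

/-! ### Area and Carleson squares -/

/-! Write `σ` for the measure with density `1 / u`, `d = 1 - ‖a‖`, and `K_a` for the reproducing
kernel at `a`. Everything is reduced to a local condition, `VanishingOnCells`: the `ν`-mass of a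
small disc about `a` of radius proportional to `d` is `o(μ(cell a 1))` as `a` tends to the circle.

The weight enters through two opposite inequalities. Cauchy–Schwarz gives `A(E)² ≤ μ(E) σ(E)` for
every measurable `E`, and `B₂` gives the converse up to a constant on the windows `disc ∩ ball a ρ`
with `ρ ≥ d`. Hence a subset with a fixed share of the area of a window has a fixed share of its
weight. This yields comparability of neighbouring cells, geometric growth of `σ` on concentric
windows, and from these `‖B_a‖² ≲ μ(cell a 1) / d⁴`. Testing point evaluation on `B_a`, and the
sub-mean-value property on `K_a`, gives `‖K_a‖² ≈ 1 / μ(cell a 1)`; by the Schwarz lemma `|K_a| ≥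
‖K_a‖² / 2` on a small cell about `a`.

Compactness of the Toeplitz operator on kernels implies the local condition, because `⟨T K_a, K_a⟩ =
∫ |K_a|² dν` dominates `‖K_a‖⁴ ν(cell a ε) / 4` while the normalized kernels are weakly null. A
vanishing Berezin transform implies it because `|B_a|²` is at least of order `d⁻⁴` on the cell.
Conversely, the local condition and averaging of `|F|²` over cells give, by Tonelli,
`VanishingTails`: near the circle the `L²(ν)` mass of every analytic `F` is at most `δ` times its
`L²(μ)` mass. Tails make the inclusion `i` into `L²(ν)` compact, since on a smaller closed disc
finitely many point values suffice, and they make the Berezin transform vanish, since `‖B_a‖ → ∞`.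
Finally `i* i` is the Toeplitz operator, given by its integral on all of `A²(u)`. -/

theorem area_apply_le (s : Set ℂ) : area s ≤ (ENNReal.ofReal Real.pi)⁻¹ * volume s := by
  simp only [area, Measure.smul_apply, smul_eq_mul]
  gcongr
  exact Measure.restrict_le_self

theorem pi_inv_mul_ofReal (r : ℝ) :
    (ENNReal.ofReal Real.pi)⁻¹ * (ENNReal.ofReal r ^ 2 * NNReal.pi) = ENNReal.ofReal r ^ 2 := by
  have h : (NNReal.pi : ℝ≥0∞) = ENNReal.ofReal Real.pi := by
    rw [← NNReal.coe_real_pi, ENNReal.ofReal_coe_nnreal]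
  rw [h, mul_comm, mul_assoc, ENNReal.mul_inv_cancel (by simp [Real.pi_pos]) (by simp), mul_one]

theorem area_closedBall_le (a : ℂ) (r : ℝ) : area (closedBall a r) ≤ ENNReal.ofReal r ^ 2 := by
  refine (area_apply_le _).trans ?_
  rw [Complex.volume_closedBall, pi_inv_mul_ofReal]

theorem area_ball {a : ℂ} {r : ℝ} (h : ball a r ⊆ disc) :
    area (ball a r) = ENNReal.ofReal r ^ 2 := by
  simp only [area, Measure.smul_apply, smul_eq_mul]
  rw [Measure.restrict_apply measurableSet_ball, Set.inter_eq_self_of_subset_left h,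
    Complex.volume_ball, pi_inv_mul_ofReal]

theorem area_compl_disc : area discᶜ = 0 := by
  rw [area, Measure.smul_apply, Measure.restrict_apply measurableSet_ball.compl]
  simp

instance : IsFiniteMeasure area := by
  refine ⟨?_⟩
  rw [← Set.union_compl_self disc]
  refine (measure_union_le _ _).trans_lt ?_
  rw [area_compl_disc, area_ball subset_rfl]
  simp

theorem measurableSet_disc : MeasurableSet disc := measurableSet_ball

theorem norm_exp_sub_exp_le (t θ : ℝ) :
    ‖Complex.exp (t * Complex.I) - Complex.exp (θ * Complex.I)‖ ≤ |t - θ| := by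
  have h : Complex.exp (t * Complex.I) - Complex.exp (θ * Complex.I) =
      Complex.exp (θ * Complex.I) * (Complex.exp (Complex.I * ((t - θ : ℝ) : ℂ)) - 1) := by
    rw [mul_sub, ← Complex.exp_add, mul_one]
    congr 2
    push_cast; ring
  rw [h, norm_mul, Complex.norm_exp_ofReal_mul_I, one_mul]
  simpa using Real.norm_exp_I_mul_ofReal_sub_one_le (x := t - θ)

theorem carlesonSquare_subset {θ h : ℝ} (h0 : 0 < h) :
    carlesonSquare θ (2 * Real.pi * h) ⊆ closedBall (Complex.exp (θ * Complex.I)) (5 * h) := by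
  rintro z ⟨r, t, ht, hr, hr1, rfl⟩
  have hpi := Real.pi_pos
  have e1 : 2 * Real.pi * h / (2 * Real.pi) = h := by field_simp
  rw [e1] at hr
  rw [mem_closedBall, dist_eq_norm]
  have e2 : (r : ℂ) * Complex.exp (t * Complex.I) - Complex.exp (θ * Complex.I) =
      ((r - 1 : ℝ) : ℂ) * Complex.exp (t * Complex.I) +
        (Complex.exp (t * Complex.I) - Complex.exp (θ * Complex.I)) := by
    push_cast; ring
  rw [e2]
  refine (norm_add_le _ _).trans ?_
  rw [norm_mul, Complex.norm_exp_ofReal_mul_I, mul_one, Complex.norm_real, Real.norm_eq_abs]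
  have h3 := norm_exp_sub_exp_le t θ
  have h4 : |r - 1| ≤ h := by rw [abs_le]; constructor <;> linarith
  -- Radial displacement at most `h` plus angular displacement at most `π h < 4 h`: this is the
  -- factor 5.
  nlinarith [Real.pi_lt_four]

theorem mem_carlesonSquare {θ h : ℝ} {z : ℂ} (hz : ‖z‖ < 1) (hh : 1 - h ≤ ‖z‖)
    (harg : |(z * Complex.exp (-θ * Complex.I)).arg| ≤ Real.pi * h) :
    z ∈ carlesonSquare θ (2 * Real.pi * h) := by
  have hpi := Real.pi_pos
  -- The argument is taken after rotating by `-θ`, so the branch cut of `arg` lies opposite the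
  -- midpoint of the arc.
  refine ⟨‖z‖, θ + (z * Complex.exp (-θ * Complex.I)).arg, ?_, ?_, hz, ?_⟩
  · rw [add_sub_cancel_left]; linarith
  · have e1 : 2 * Real.pi * h / (2 * Real.pi) = h := by field_simp
    rwa [e1]
  · have h2 := Complex.norm_mul_exp_arg_mul_I (z * Complex.exp (-θ * Complex.I))
    have h3 : ‖z * Complex.exp (-θ * Complex.I)‖ = ‖z‖ := by
      rw [norm_mul, ← Complex.ofReal_neg, Complex.norm_exp_ofReal_mul_I, mul_one]
    rw [h3] at h2
    push_cast
    rw [add_mul, Complex.exp_add, mul_left_comm, h2, mul_left_comm, ← Complex.exp_add]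
    simp

theorem disc_subset_carlesonSquare : disc ⊆ carlesonSquare 0 (2 * Real.pi * 1) := by
  intro z hz
  refine mem_carlesonSquare (by simpa using hz) (by simp) ?_
  rw [mul_one]
  exact Complex.abs_arg_le_pi _

theorem abs_arg_le_of_norm_sub_one_le {w : ℂ} {h : ℝ} (h1 : h ≤ 1)
    (hw : ‖w - 1‖ ≤ h / 2) : |w.arg| ≤ Real.pi * h := by
  have hpi := Real.pi_pos
  have hre : 1 / 2 ≤ w.re := by
    have := (Complex.abs_re_le_norm (w - 1)).trans hw
    rw [Complex.sub_re, Complex.one_re, abs_le] at this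
    linarith
  have him : |w.im| ≤ h / 2 := by
    have := (Complex.abs_im_le_norm (w - 1)).trans hw
    simpa using this
  have hn : 1 / 2 ≤ ‖w‖ := hre.trans (Complex.re_le_norm w)
  have hw0 : w ≠ 0 := by rintro rfl; norm_num at hn
  have harg : |w.arg| ≤ Real.pi / 2 := Complex.abs_arg_le_pi_div_two_iff.2 (by linarith)
  have hs : Real.sin |w.arg| ≤ h := by
    have h2 : Real.sin |w.arg| = |w.im| / ‖w‖ := by
      rw [← Real.abs_sin_eq_sin_abs_of_abs_le_pi (harg.trans (by linarith)), Complex.sin_arg,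
        abs_div, abs_norm]
    rw [h2, div_le_iff₀ (by linarith)]
    have : 0 ≤ h := by linarith [abs_nonneg w.im]
    nlinarith
  -- Jordan's inequality `2 x / π ≤ sin x` on `[0, π/2]` turns the bound on the sine into one on the
  -- angle.
  have h3 := Real.mul_le_sin (abs_nonneg w.arg) harg
  have h4 : 2 / Real.pi * |w.arg| ≤ h := h3.trans hs
  rw [div_mul_eq_mul_div, div_le_iff₀ hpi] at h4
  nlinarith [abs_nonneg w.arg]

theorem disc_inter_closedBall_subset_carlesonSquare {θ h : ℝ} (h1 : h ≤ 1) :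
    disc ∩ closedBall (Complex.exp (θ * Complex.I)) (h / 2) ⊆
      carlesonSquare θ (2 * Real.pi * h) := by
  rintro z ⟨hz, hz'⟩
  rw [mem_closedBall, dist_eq_norm] at hz'
  refine mem_carlesonSquare (by simpa using hz) ?_ (abs_arg_le_of_norm_sub_one_le h1 ?_)
  · have h2 := norm_sub_norm_le (Complex.exp (θ * Complex.I)) z
    rw [norm_sub_rev, Complex.norm_exp_ofReal_mul_I] at h2
    have := norm_nonneg (z - Complex.exp (θ * Complex.I))
    linarith
  · have h2 : z * Complex.exp (-θ * Complex.I) - 1 =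
        (z - Complex.exp (θ * Complex.I)) * Complex.exp ((-θ : ℝ) * Complex.I) := by
      rw [sub_mul, ← Complex.exp_add]
      simp
    rwa [h2, norm_mul, Complex.norm_exp_ofReal_mul_I, mul_one]

/-- The part of the disc within distance `ρ` of `a`. -/
def window (a : ℂ) (ρ : ℝ) : Set ℂ := disc ∩ ball a ρ

theorem measurableSet_window (a : ℂ) (ρ : ℝ) : MeasurableSet (window a ρ) :=
  measurableSet_ball.inter measurableSet_ball

theorem window_subset_disc (a : ℂ) (ρ : ℝ) : window a ρ ⊆ disc := Set.inter_subset_left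

theorem window_mono {a b : ℂ} {ρ R : ℝ} (h : ρ + dist a b ≤ R) : window a ρ ⊆ window b R :=
  Set.inter_subset_inter_right _ (ball_subset_ball' h)

theorem exists_window_subset {a : ℂ} (ha : a ∈ disc) {ρ : ℝ} (hρ : 1 - ‖a‖ ≤ ρ) :
    ∃ θ h : ℝ, 0 < h ∧ h ≤ 1 ∧ h ≤ 4 * ρ ∧ window a ρ ⊆ carlesonSquare θ (2 * Real.pi * h) := by
  have ha1 : ‖a‖ < 1 := by simpa using ha
  have hρ0 : 0 < ρ := by linarith
  by_cases h : 4 * ρ ≤ 1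
  · refine ⟨a.arg, 4 * ρ, by linarith, h, le_rfl, ?_⟩
    refine Set.Subset.trans ?_ (disc_inter_closedBall_subset_carlesonSquare h)
    refine Set.inter_subset_inter_right _ fun z hz => ?_
    rw [mem_ball, dist_eq_norm] at hz
    rw [mem_closedBall, dist_eq_norm]
    have h2 : ‖a - Complex.exp (a.arg * Complex.I)‖ ≤ ρ := by
      have h3 : a - Complex.exp (a.arg * Complex.I) =
          ((‖a‖ - 1 : ℝ) : ℂ) * Complex.exp (a.arg * Complex.I) := by
        push_cast
        rw [sub_mul, Complex.norm_mul_exp_arg_mul_I, one_mul]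
      rw [h3, norm_mul, Complex.norm_exp_ofReal_mul_I, mul_one, Complex.norm_real,
        Real.norm_eq_abs, abs_le]
      constructor <;> linarith
    have := norm_sub_le_norm_sub_add_norm_sub z a (Complex.exp (a.arg * Complex.I))
    linarith
  -- For large `ρ` the square over the whole circle, which contains the disc, serves as the
  -- container.
  · push Not at h
    exact ⟨0, 1, one_pos, le_rfl, h.le,
      (window_subset_disc a ρ).trans disc_subset_carlesonSquare⟩

/-! ### Weighted measures -/

theorem aemeasurable_ofReal {u : ℂ → ℝ} (hu : IsB2Weight u) :
    AEMeasurable (fun z => ENNReal.ofReal (u z)) area :=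
  hu.integrable.aestronglyMeasurable.aemeasurable.ennreal_ofReal

theorem weightMeasure_apply {u : ℂ → ℝ} {s : Set ℂ} (hs : MeasurableSet s) :
    weightMeasure u s = ∫⁻ z in s, ENNReal.ofReal (u z) ∂area := withDensity_apply _ hs

theorem setLIntegral_weightMeasure {u : ℂ → ℝ} (hu : IsB2Weight u) {s : Set ℂ}
    (hs : MeasurableSet s) (g : ℂ → ℝ≥0∞) :
    ∫⁻ z in s, g z ∂(weightMeasure u) = ∫⁻ z in s, ENNReal.ofReal (u z) * g z ∂area := by
  rw [weightMeasure, restrict_withDensity hs,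
    lintegral_withDensity_eq_lintegral_mul_non_measurable₀ _ (aemeasurable_ofReal hu).restrict
      (Eventually.of_forall fun _ => ENNReal.ofReal_lt_top)]
  rfl

theorem weightMeasure_compl_disc (u : ℂ → ℝ) : weightMeasure u discᶜ = 0 :=
  withDensity_absolutelyContinuous _ _ area_compl_disc

theorem ae_mem_disc (u : ℂ → ℝ) : ∀ᵐ z ∂(weightMeasure u), z ∈ disc :=
  weightMeasure_compl_disc u

theorem isFiniteMeasure_weightMeasure {u : ℂ → ℝ} (hu : IsB2Weight u) :
    IsFiniteMeasure (weightMeasure u) := by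
  refine isFiniteMeasure_withDensity_ofReal hu.integrable.2

theorem area_disc : area disc = 1 := by
  rw [area_ball subset_rfl]; simp

theorem lintegral_ofReal_ne_zero {u : ℂ → ℝ} (hu : IsB2Weight u) :
    ∫⁻ z, ENNReal.ofReal (u z) ∂area ≠ 0 := by
  intro h
  rw [lintegral_eq_zero_iff' (aemeasurable_ofReal hu)] at h
  have h2 : ∀ᵐ z ∂area, False := by
    filter_upwards [h, hu.pos] with z hz hp
    simp at hz
    linarith
  rw [ae_iff] at h2
  have : area disc ≤ 0 := h2 ▸ measure_mono fun _ _ => by simp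
  simp [area_disc] at this

/-- The product in `B₂` is symmetric in `u` and `1 / u`. Integrability of `1 / u` is the condition
on the square over the whole circle, where the other factor `∫ u` is nonzero. -/
theorem IsB2Weight.inv {u : ℂ → ℝ} (hu : IsB2Weight u) : IsB2Weight fun z => (u z)⁻¹ where
  integrable := by
    refine ⟨hu.integrable.aestronglyMeasurable.inv₀, ?_⟩
    obtain ⟨C, hC⟩ := hu.bound
    have h := hC 0 (2 * Real.pi * 1) (by positivity) (by simp)
    have hae : ∀ᵐ z ∂area, z ∈ carlesonSquare 0 (2 * Real.pi * 1) := by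
      have : ∀ᵐ z ∂area, z ∈ disc := area_compl_disc
      exact this.mono fun z hz => disc_subset_carlesonSquare hz
    rw [Measure.restrict_eq_self_of_ae_mem hae] at h
    have h2 : ∫⁻ z, ENNReal.ofReal (u z)⁻¹ ∂area < ∞ := by
      have hlt := h.trans_lt (ENNReal.mul_lt_top ENNReal.coe_lt_top
        (ENNReal.pow_lt_top (measure_lt_top _ _)))
      rcases ENNReal.mul_lt_top_iff.1 hlt with h3 | h3 | h3
      · exact h3.2
      · exact absurd h3 (lintegral_ofReal_ne_zero hu)
      · simp [h3]
    rw [HasFiniteIntegral]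
    refine lt_of_eq_of_lt (lintegral_congr_ae ?_) h2
    filter_upwards [hu.pos] with z hz
    rw [Real.enorm_eq_ofReal (inv_nonneg.2 hz.le)]
  pos := hu.pos.mono fun z hz => inv_pos.2 hz
  bound := by
    obtain ⟨C, hC⟩ := hu.bound
    refine ⟨C, fun θ L h0 h1 => ?_⟩
    rw [mul_comm]
    simpa using hC θ L h0 h1

/-- Cauchy–Schwarz for the factorization `g = (g u^(1/2)) · u^(-1/2)`. -/
theorem lintegral_sq_le {u : ℂ → ℝ} (hu : IsB2Weight u) {s : Set ℂ} (hs : MeasurableSet s)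
    {g : ℂ → ℝ≥0∞} (hg : AEMeasurable g (area.restrict s)) :
    (∫⁻ z in s, g z ∂area) ^ 2 ≤
      (∫⁻ z in s, g z ^ 2 ∂(weightMeasure u)) * weightMeasure (fun z => (u z)⁻¹) s := by
  rw [setLIntegral_weightMeasure hu hs, weightMeasure_apply hs]
  set a : ℂ → ℝ≥0∞ := fun z => ENNReal.ofReal (u z) ^ (1 / 2 : ℝ) with ha
  set b : ℂ → ℝ≥0∞ := fun z => ENNReal.ofReal (u z)⁻¹ ^ (1 / 2 : ℝ) with hb
  have ham : AEMeasurable a (area.restrict s) := (aemeasurable_ofReal hu).restrict.pow_const _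
  have hbm : AEMeasurable b (area.restrict s) := (aemeasurable_ofReal hu.inv).restrict.pow_const _
  have h1 : ∫⁻ z in s, g z ∂area = ∫⁻ z in s, ((fun z => g z * a z) * b) z ∂area := by
    refine lintegral_congr_ae (ae_restrict_of_ae ?_)
    filter_upwards [hu.pos] with z hz
    have : a z * b z = 1 := by
      rw [ha, hb, ← ENNReal.mul_rpow_of_nonneg _ _ (by norm_num), ← ENNReal.ofReal_mul hz.le,
        mul_inv_cancel₀ hz.ne']
      simp
    simp [Pi.mul_apply, mul_assoc, this]
  have h2 := ENNReal.lintegral_mul_le_Lp_mul_Lq (area.restrict s) Real.HolderConjugate.two_two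
    (hg.mul ham) hbm
  have e : ∀ x : ℝ≥0∞, (x ^ (1 / 2 : ℝ)) ^ 2 = x := fun x => by
    rw [← ENNReal.rpow_natCast, ← ENNReal.rpow_mul]; norm_num
  have e' : ∀ x : ℝ≥0∞, (x ^ (1 / 2 : ℝ)) ^ (2 : ℝ) = x := fun x => by
    rw [← ENNReal.rpow_mul]; norm_num
  rw [h1]
  refine (pow_le_pow_left₀ zero_le h2 2).trans (le_of_eq ?_)
  rw [mul_pow, e, e]
  congr 1
  · refine lintegral_congr fun z => ?_
    simp only [Pi.mul_apply, ha]
    rw [ENNReal.mul_rpow_of_nonneg _ _ (by norm_num), e', mul_comm]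
    simp
  · refine lintegral_congr fun z => ?_
    simp only [hb, e']

theorem area_sq_le {u : ℂ → ℝ} (hu : IsB2Weight u) {s : Set ℂ} (hs : MeasurableSet s) :
    area.real s ^ 2 ≤ (weightMeasure u).real s * (weightMeasure fun z => (u z)⁻¹).real s := by
  have := isFiniteMeasure_weightMeasure hu
  have := isFiniteMeasure_weightMeasure hu.inv
  have h := lintegral_sq_le hu hs (g := fun _ => 1) aemeasurable_const
  simp only [setLIntegral_const, one_mul, one_pow] at h
  have h2 := ENNReal.toReal_mono (by finiteness) h
  simpa [Measure.real, ENNReal.toReal_mul] using h2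

/-- Transfers `B₂` from Carleson squares to Euclidean windows, whose inclusions follow from the
triangle inequality: a window lies in a square of comparable size. -/
theorem exists_window_bound {u : ℂ → ℝ} (hu : IsB2Weight u) :
    ∃ C : ℝ, 0 < C ∧ ∀ a ∈ disc, ∀ ρ : ℝ, 1 - ‖a‖ ≤ ρ →
      (weightMeasure u).real (window a ρ) * (weightMeasure fun z => (u z)⁻¹).real (window a ρ) ≤
        C * ρ ^ 4 := by
  have := isFiniteMeasure_weightMeasure hu
  have := isFiniteMeasure_weightMeasure hu.inv
  obtain ⟨C, hC⟩ := hu.bound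
  -- The square lies in a disc of radius `5 h ≤ 20 ρ`; `C + 1` keeps the constant positive when `C =
  -- 0`.
  refine ⟨(C + 1) * (20 ^ 4), by positivity, fun a ha ρ hρ => ?_⟩
  have ha1 : ‖a‖ < 1 := by simpa using ha
  obtain ⟨θ, h, h0, h1, hρ4, hsub⟩ := exists_window_subset ha hρ
  have h2 := hC θ (2 * Real.pi * h) (by positivity)
    (by nlinarith [Real.pi_pos])
  have h3 : weightMeasure u (window a ρ) * weightMeasure (fun z => (u z)⁻¹) (window a ρ) ≤
      C * (ENNReal.ofReal (5 * h) ^ 2) ^ 2 := by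
    rw [weightMeasure_apply (measurableSet_window _ _),
      weightMeasure_apply (measurableSet_window _ _)]
    refine (mul_le_mul' (lintegral_mono_set hsub) (lintegral_mono_set hsub)).trans (h2.trans ?_)
    gcongr
    exact (measure_mono (carlesonSquare_subset h0)).trans (area_closedBall_le _ _)
  have h4 := ENNReal.toReal_mono (by finiteness) h3
  simp only [ENNReal.toReal_mul, ENNReal.toReal_pow, ENNReal.coe_toReal,
    ENNReal.toReal_ofReal (show 0 ≤ 5 * h by positivity)] at h4
  refine h4.trans ?_
  have h5 : (5 * h) ≤ 20 * ρ := by linarith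
  calc (C : ℝ) * ((5 * h) ^ 2) ^ 2 ≤ (C + 1) * ((20 * ρ) ^ 2) ^ 2 := by
        gcongr
        linarith
    _ = _ := by ring

/-- A subset of a window which is large in area is large in weight. -/
theorem weight_window_le {u : ℂ → ℝ} (hu : IsB2Weight u) {C : ℝ} {a : ℂ} {ρ κ : ℝ}
    (hρ : 0 < ρ) (hκ : 0 < κ)
    (hC : (weightMeasure u).real (window a ρ) *
      (weightMeasure fun z => (u z)⁻¹).real (window a ρ) ≤ C * ρ ^ 4)
    {E : Set ℂ} (hE : MeasurableSet E) (hsub : E ⊆ window a ρ) (hA : κ * ρ ^ 2 ≤ area.real E) :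
    (weightMeasure u).real (window a ρ) ≤ C / κ ^ 2 * (weightMeasure u).real E := by
  have := isFiniteMeasure_weightMeasure hu
  have := isFiniteMeasure_weightMeasure hu.inv
  have h1 := area_sq_le hu hE
  have h2 : (weightMeasure fun z => (u z)⁻¹).real E ≤
    (weightMeasure fun z => (u z)⁻¹).real (window a ρ) := measureReal_mono hsub
  set m := (weightMeasure u).real (window a ρ)
  set s := (weightMeasure fun z => (u z)⁻¹).real (window a ρ)
  set mE := (weightMeasure u).real E
  have hm : 0 ≤ m := measureReal_nonneg
  have hmE : 0 ≤ mE := measureReal_nonneg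
  have h3 : (κ * ρ ^ 2) ^ 2 ≤ mE * s :=
    (pow_le_pow_left₀ (by positivity) hA 2).trans (h1.trans (by gcongr))
  rw [div_mul_eq_mul_div, le_div_iff₀ (by positivity)]
  have hρ4 : 0 < ρ ^ 4 := by positivity
  refine le_of_mul_le_mul_right ?_ hρ4
  calc m * κ ^ 2 * ρ ^ 4 = m * (κ * ρ ^ 2) ^ 2 := by ring
    _ ≤ m * (mE * s) := by gcongr
    _ = mE * (m * s) := by ring
    _ ≤ mE * (C * ρ ^ 4) := by gcongr
    _ = _ := by ring

/-! ### Cells and the norm of the unweighted Bergman kernel -/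

/-- `C` bounds the products of the masses of `u` and `1 / u` on all windows. -/
def IsWindowConst (u : ℂ → ℝ) (C : ℝ) : Prop :=
  ∀ a ∈ disc, ∀ ρ : ℝ, 1 - ‖a‖ ≤ ρ →
    (weightMeasure u).real (window a ρ) * (weightMeasure fun z => (u z)⁻¹).real (window a ρ) ≤
      C * ρ ^ 4

theorem IsWindowConst.inv {u : ℂ → ℝ} {C : ℝ} (h : IsWindowConst u C) :
    IsWindowConst (fun z => (u z)⁻¹) C := fun a ha ρ hρ => by
  simpa [mul_comm] using h a ha ρ hρ

/-- The disc with centre `a` whose radius is `ε` times the distance of `a` to the unit circle. -/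
def cell (a : ℂ) (ε : ℝ) : Set ℂ := ball a (ε * (1 - ‖a‖))

theorem measurableSet_cell (a : ℂ) (ε : ℝ) : MeasurableSet (cell a ε) := measurableSet_ball

theorem cell_subset_disc {a : ℂ} (ha : a ∈ disc) {ε : ℝ} (h1 : ε ≤ 1) : cell a ε ⊆ disc := by
  have ha1 : ‖a‖ < 1 := by simpa using ha
  refine ball_subset_ball' ?_
  rw [dist_zero_right]
  nlinarith

theorem area_cell {a : ℂ} (ha : a ∈ disc) {ε : ℝ} (h0 : 0 ≤ ε) (h1 : ε ≤ 1) :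
    area.real (cell a ε) = ε ^ 2 * (1 - ‖a‖) ^ 2 := by
  have ha1 : ‖a‖ < 1 := by simpa using ha
  rw [Measure.real, cell, area_ball (cell_subset_disc ha h1), ENNReal.toReal_pow,
    ENNReal.toReal_ofReal (mul_nonneg h0 (by linarith)), mul_pow]

theorem window_eq_cell {a : ℂ} (ha : a ∈ disc) : window a (1 - ‖a‖) = cell a 1 := by
  rw [cell, one_mul]
  refine Set.inter_eq_self_of_subset_right ?_
  simpa [cell] using cell_subset_disc ha le_rfl

theorem cell_measure_pos {u : ℂ → ℝ} (hu : IsB2Weight u) {a : ℂ} (ha : a ∈ disc) {ε : ℝ}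
    (h0 : 0 < ε) (h1 : ε ≤ 1) : 0 < (weightMeasure u).real (cell a ε) := by
  have ha1 : ‖a‖ < 1 := by simpa using ha
  have h := area_sq_le hu (measurableSet_cell a ε)
  rw [area_cell ha h0.le h1] at h
  have hd : 0 < 1 - ‖a‖ := by linarith
  refine pos_of_mul_pos_left (lt_of_lt_of_le ?_ h) measureReal_nonneg
  positivity

/-- Both cells lie in the window of radius `4 (1 - ‖a‖)` about `a` and fill at least `1/64` of the
square of its radius, so `weight_window_le` applies with `64² = 4096`. -/
theorem cell_comparable {u : ℂ → ℝ} (hu : IsB2Weight u) {C : ℝ} (hC : IsWindowConst u C) {a b : ℂ}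
    (ha : a ∈ disc) (hb : b ∈ cell a (1 / 2)) :
    (weightMeasure u).real (cell a 1) ≤ 4096 * C * (weightMeasure u).real (cell b 1) ∧
      (weightMeasure u).real (cell b 1) ≤ 4096 * C * (weightMeasure u).real (cell a 1) := by
  have := isFiniteMeasure_weightMeasure hu
  have ha1 : ‖a‖ < 1 := by simpa using ha
  have hbd : b ∈ disc := cell_subset_disc ha (by norm_num) hb
  rw [cell, mem_ball, dist_eq_norm] at hb
  have h1 := norm_sub_norm_le b a
  have h2 := norm_sub_norm_le a b
  rw [norm_sub_rev] at h2
  have hd : 0 < 1 - ‖a‖ := by linarith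
  have ea : cell a 1 ⊆ window a (4 * (1 - ‖a‖)) := by
    rw [← window_eq_cell ha]
    refine window_mono ?_
    rw [dist_self]; linarith
  have eb : cell b 1 ⊆ window a (4 * (1 - ‖a‖)) := by
    rw [← window_eq_cell hbd]
    refine window_mono ?_
    rw [dist_eq_norm]; linarith
  have hw := hC a ha (4 * (1 - ‖a‖)) (by linarith)
  have ka := weight_window_le hu (κ := 1 / 64) (by linarith) (by norm_num) hw
    (measurableSet_cell a 1) ea (by rw [area_cell ha zero_le_one le_rfl]; nlinarith)
  have kb := weight_window_le hu (κ := 1 / 64) (by linarith) (by norm_num) hw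
    (measurableSet_cell b 1) eb (by rw [area_cell hbd zero_le_one le_rfl]; nlinarith)
  have e : C / (1 / 64) ^ 2 = 4096 * C := by ring
  rw [e] at ka kb
  exact ⟨(measureReal_mono ea).trans kb, (measureReal_mono eb).trans ka⟩

/-- The annulus between two concentric windows carries a fixed share of the mass. -/
theorem window_add_le {u : ℂ → ℝ} (hu : IsB2Weight u) {C : ℝ} (hC : IsWindowConst u C) {a : ℂ}
    (ha : a ∈ disc) {R : ℝ} (hR : 1 - ‖a‖ ≤ R) (hR1 : 4 * R ≤ 1) :
    ∃ t : ℝ, (weightMeasure u).real (window a R) + t ≤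
      (weightMeasure u).real (window a (4 * R)) ∧
      (weightMeasure u).real (window a (4 * R)) ≤ 256 * C * t := by
  have := isFiniteMeasure_weightMeasure hu
  have ha1 : ‖a‖ < 1 := by simpa using ha
  have hR0 : 0 < R := by linarith
  set ζ := Complex.exp (a.arg * Complex.I) with hζ
  have hζn : ‖ζ‖ = 1 := Complex.norm_exp_ofReal_mul_I _
  have haζ : a = (‖a‖ : ℂ) * ζ := (Complex.norm_mul_exp_arg_mul_I a).symm
  -- Moving from `a` by `2 R` along the inward radial direction gives a disc of radius `R` that
  -- avoids `ball a R` and stays inside both the unit disc and `ball a (4 * R)`.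
  set b := a - ((2 * R : ℝ) : ℂ) * ζ with hb
  have hab : dist b a = 2 * R := by
    rw [dist_eq_norm, hb, sub_sub_cancel_left, norm_neg, norm_mul, hζn, mul_one, Complex.norm_real,
      Real.norm_of_nonneg (by linarith)]
  have hbn : ‖b‖ = |‖a‖ - 2 * R| := by
    have : b = ((‖a‖ - 2 * R : ℝ) : ℂ) * ζ := by
      rw [hb]; nth_rewrite 1 [haζ]; push_cast; ring
    rw [this, norm_mul, hζn, mul_one, Complex.norm_real, Real.norm_eq_abs]
  have hbd : ball b R ⊆ disc := by
    refine ball_subset_ball' ?_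
    have : |‖a‖ - 2 * R| ≤ 1 - R := by
      rw [abs_le]; constructor <;> linarith [norm_nonneg a]
    rw [dist_zero_right, hbn]; linarith
  have hE : ball b R ⊆ window a (4 * R) :=
    Set.subset_inter hbd (ball_subset_ball' (by linarith))
  have hdisj : Disjoint (window a R) (ball b R) := by
    refine Disjoint.mono_left Set.inter_subset_right ?_
    refine ball_disjoint_ball ?_
    rw [dist_comm, hab]; linarith
  refine ⟨(weightMeasure u).real (ball b R), ?_, ?_⟩
  · rw [← measureReal_union hdisj measurableSet_ball]
    refine measureReal_mono (Set.union_subset (window_mono ?_) hE)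
    rw [dist_self]; linarith
  · have h := weight_window_le hu (κ := 1 / 16) (by linarith) (by norm_num)
      (hC a ha (4 * R) (by linarith)) measurableSet_ball hE (by
        rw [Measure.real, area_ball hbd, ENNReal.toReal_pow, ENNReal.toReal_ofReal hR0.le]
        nlinarith)
    have e : C / (1 / 16) ^ 2 = 256 * C := by ring
    rwa [e] at h

theorem disc_eq_window : disc = window 0 1 := by simp [window]

theorem lintegral_far_le {u : ℂ → ℝ} {a : ℂ} {R : ℝ} (hR : 0 < R) (s t : Set ℂ)
    (hs : MeasurableSet s) (h : s ⊆ (ball a R)ᶜ) (hst : s ⊆ t) [IsFiniteMeasure (weightMeasure u)] :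
    ∫⁻ z in s, ENNReal.ofReal ((‖z - a‖ ^ 4)⁻¹) ∂(weightMeasure u) ≤
      ENNReal.ofReal ((R ^ 4)⁻¹ * (weightMeasure u).real t) := by
  calc _ ≤ ∫⁻ _ in s, ENNReal.ofReal ((R ^ 4)⁻¹) ∂(weightMeasure u) := by
        refine setLIntegral_mono' hs fun z hz => ?_
        have h2 : R ≤ ‖z - a‖ := by simpa [dist_eq_norm] using h hz
        gcongr
    _ ≤ ENNReal.ofReal ((R ^ 4)⁻¹) * weightMeasure u t := by
        rw [setLIntegral_const]; gcongr
    _ = _ := by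
        rw [ENNReal.ofReal_mul (by positivity), Measure.real, ENNReal.ofReal_toReal (by finiteness)]

theorem window_measure_pos {u : ℂ → ℝ} (hu : IsB2Weight u) {a : ℂ} (ha : a ∈ disc) {R : ℝ}
    (hR : 1 - ‖a‖ ≤ R) : 0 < (weightMeasure u).real (window a R) := by
  have := isFiniteMeasure_weightMeasure hu
  refine (cell_measure_pos hu ha one_pos le_rfl).trans_le ?_
  rw [← window_eq_cell ha]
  refine measureReal_mono (window_mono ?_)
  rw [dist_self]; linarith

/-- Summation over annuli of ratio 4; `n` only bounds how often `R` can be quadrupled before the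
window exhausts the disc. By `B₂` each annulus contributes at most `256 C / σ(window a (4 R))`, and
`σ` of the windows grows geometrically, so the sum is governed by its first term. -/
theorem lintegral_tail_le {u : ℂ → ℝ} (hu : IsB2Weight u) {C : ℝ} (hC0 : 0 < C)
    (hC : IsWindowConst u C) {a : ℂ} (ha : a ∈ disc) (n : ℕ) :
    ∀ R : ℝ, 1 - ‖a‖ ≤ R → 1 < 4 ^ (n + 1) * R →
      ∫⁻ z in disc \ ball a R, ENNReal.ofReal ((‖z - a‖ ^ 4)⁻¹) ∂(weightMeasure u) ≤
        ENNReal.ofReal (256 * C * (256 * C + 1) /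
          (weightMeasure fun z => (u z)⁻¹).real (window a R)) := by
  have := isFiniteMeasure_weightMeasure hu
  have := isFiniteMeasure_weightMeasure hu.inv
  have ha1 : ‖a‖ < 1 := by simpa using ha
  have base : ∀ R : ℝ, 1 - ‖a‖ ≤ R → 1 < 4 * R →
      ∫⁻ z in disc \ ball a R, ENNReal.ofReal ((‖z - a‖ ^ 4)⁻¹) ∂(weightMeasure u) ≤
        ENNReal.ofReal (256 * C * (256 * C + 1) /
          (weightMeasure fun z => (u z)⁻¹).real (window a R)) := by
    intro R hR h4
    have hs := window_measure_pos hu.inv ha hR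
    refine (lintegral_far_le (by linarith) _ disc (measurableSet_disc.diff measurableSet_ball)
      (fun z hz => hz.2) Set.sdiff_subset).trans ?_
    refine ENNReal.ofReal_le_ofReal ?_
    have h1 := hC 0 (by simp) 1 (by simp)
    rw [← disc_eq_window] at h1
    have h2 : (weightMeasure fun z => (u z)⁻¹).real (window a R) ≤
      (weightMeasure fun z => (u z)⁻¹).real disc := measureReal_mono (window_subset_disc _ _)
    have h3 : (R ^ 4)⁻¹ ≤ 256 := by
      have : (1 / 4 : ℝ) ^ 4 ≤ R ^ 4 := by gcongr; linarith
      calc (R ^ 4)⁻¹ ≤ ((1 / 4 : ℝ) ^ 4)⁻¹ := by gcongr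
        _ = 256 := by norm_num
    have hm : 0 ≤ (weightMeasure u).real disc := measureReal_nonneg
    rw [le_div_iff₀ hs]
    calc _ ≤ 256 * (weightMeasure u).real disc *
          (weightMeasure fun z => (u z)⁻¹).real disc := by gcongr
      _ ≤ 256 * C := by linarith
      _ ≤ _ := by nlinarith
  induction n with
  | zero => intro R hR h; exact base R hR (by simpa using h)
  | succ n ih =>
    intro R hR hn
    rcases lt_or_ge 1 (4 * R) with h4 | h4
    · exact base R hR h4
    have hR0 : 0 < R := by linarith
    have hs := window_measure_pos hu.inv ha hR
    have hs4 := window_measure_pos hu.inv ha (R := 4 * R) (by linarith)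
    have ih' := ih (4 * R) (by linarith) (by rw [pow_succ] at hn; linarith)
    obtain ⟨t, ht1, ht2⟩ := window_add_le hu.inv hC.inv ha hR h4
    have hw := hC a ha (4 * R) (by linarith)
    have hsplit : disc \ ball a R ⊆ (window a (4 * R) \ ball a R) ∪ (disc \ ball a (4 * R)) := by
      rintro z ⟨h1, h2⟩
      by_cases h3 : z ∈ ball a (4 * R)
      · exact Or.inl ⟨⟨h1, h3⟩, h2⟩
      · exact Or.inr ⟨h1, h3⟩
    refine (lintegral_mono_set hsplit).trans ((lintegral_union_le _ _ _).trans ?_)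
    refine (add_le_add (lintegral_far_le hR0 _ (window a (4 * R))
      ((measurableSet_window _ _).diff measurableSet_ball) (fun z hz => hz.2) Set.sdiff_subset)
      ih').trans ?_
    have hm : 0 ≤ (weightMeasure u).real (window a (4 * R)) := measureReal_nonneg
    rw [← ENNReal.ofReal_add (by positivity) (by positivity)]
    refine ENNReal.ofReal_le_ofReal ?_
    set s4 := (weightMeasure fun z => (u z)⁻¹).real (window a (4 * R))
    set s1 := (weightMeasure fun z => (u z)⁻¹).real (window a R)
    have h1 : (R ^ 4)⁻¹ * (weightMeasure u).real (window a (4 * R)) ≤ 256 * C / s4 := by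
      rw [le_div_iff₀ hs4, mul_assoc, inv_mul_le_iff₀ (by positivity)]
      linarith
    refine (add_le_add_left h1 _).trans ?_
    rw [← add_div, div_le_div_iff₀ hs4 hs]
    have h5 : 0 < 256 * C := by linarith
    generalize 256 * C = D at *
    -- From `s1 + t ≤ s4` and `s4 ≤ D t` follows `s1 ≤ (1 - 1/D) s4`. As `(D + 2)(1 - 1/D) ≤ D + 1`,
    -- the constant `D (D + 1)` reproduces itself.
    have h6 : D * s1 ≤ D * s4 - D * t := by nlinarith
    nlinarith

theorem norm_one_sub_sq_sub (a z : ℂ) :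
    ‖1 - (starRingEnd ℂ) a * z‖ ^ 2 - ‖z - a‖ ^ 2 = (1 - ‖a‖ ^ 2) * (1 - ‖z‖ ^ 2) := by
  simp only [← Complex.normSq_eq_norm_sq, Complex.normSq_apply, Complex.sub_re, Complex.sub_im,
    Complex.mul_re, Complex.mul_im, Complex.conj_re, Complex.conj_im, Complex.one_re,
    Complex.one_im]
  ring

/-- Pseudo-hyperbolic distance is at most 1. This replaces `|B_a|²` by `|z - a|⁻⁴` away from `a`,
where annuli about `a` can be summed. -/
theorem norm_sub_le_norm_one_sub {a z : ℂ} (ha : a ∈ disc) (hz : z ∈ disc) :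
    ‖z - a‖ ≤ ‖1 - (starRingEnd ℂ) a * z‖ := by
  have ha1 : ‖a‖ < 1 := by simpa using ha
  have hz1 : ‖z‖ < 1 := by simpa using hz
  have h := norm_one_sub_sq_sub a z
  refine le_of_sq_le_sq ?_ (norm_nonneg _)
  have : 0 ≤ (1 - ‖a‖ ^ 2) * (1 - ‖z‖ ^ 2) :=
    mul_nonneg (by nlinarith [norm_nonneg a]) (by nlinarith [norm_nonneg z])
  linarith

theorem one_sub_le_norm_one_sub {a z : ℂ} {t : ℝ} (h : ‖a‖ * ‖z‖ ≤ t) :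
    1 - t ≤ ‖1 - (starRingEnd ℂ) a * z‖ := by
  have h1 := norm_sub_norm_le (1 : ℂ) ((starRingEnd ℂ) a * z)
  rw [norm_one, norm_mul, RCLike.norm_conj] at h1
  linarith

theorem enorm_B_sq_le {a z : ℂ} {t : ℝ} (ht : 0 < t) (h : t ≤ ‖1 - (starRingEnd ℂ) a * z‖) :
    ‖B a z‖ₑ ^ 2 ≤ ENNReal.ofReal ((t ^ 4)⁻¹) := by
  rw [← ofReal_norm, ← ENNReal.ofReal_pow (norm_nonneg _)]
  refine ENNReal.ofReal_le_ofReal ?_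
  rw [B, norm_div, norm_one, norm_pow, one_div, inv_pow, ← pow_mul]
  gcongr

theorem le_enorm_B_sq {a z : ℂ} {t : ℝ} (h0 : 0 < ‖1 - (starRingEnd ℂ) a * z‖)
    (h : ‖1 - (starRingEnd ℂ) a * z‖ ≤ t) :
    ENNReal.ofReal ((t ^ 4)⁻¹) ≤ ‖B a z‖ₑ ^ 2 := by
  rw [← ofReal_norm, ← ENNReal.ofReal_pow (norm_nonneg _)]
  refine ENNReal.ofReal_le_ofReal ?_
  rw [B, norm_div, norm_one, norm_pow, one_div, inv_pow, ← pow_mul]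
  gcongr

theorem lintegral_eq_disc (u : ℂ → ℝ) (g : ℂ → ℝ≥0∞) :
    ∫⁻ z, g z ∂(weightMeasure u) = ∫⁻ z in disc, g z ∂(weightMeasure u) := by
  rw [Measure.restrict_eq_self_of_ae_mem (ae_mem_disc u)]

/-- The upper bound for the norm of `B a` in `A²(u)`. -/
theorem exists_lintegral_B_le {u : ℂ → ℝ} (hu : IsB2Weight u) :
    ∃ C : ℝ, 0 < C ∧ ∀ a ∈ disc, ∫⁻ z, ‖B a z‖ₑ ^ 2 ∂(weightMeasure u) ≤
      ENNReal.ofReal (C * (weightMeasure u).real (cell a 1) / (1 - ‖a‖) ^ 4) := by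
  have := isFiniteMeasure_weightMeasure hu
  have := isFiniteMeasure_weightMeasure hu.inv
  obtain ⟨C, hC0, hC⟩ := exists_window_bound hu
  refine ⟨1 + 256 * C * (256 * C + 1), by positivity, fun a ha => ?_⟩
  have ha1 : ‖a‖ < 1 := by simpa using ha
  have hd : 0 < 1 - ‖a‖ := by linarith
  have hsplit : disc ⊆ cell a 1 ∪ (disc \ ball a (1 - ‖a‖)) := by
    intro z hz
    by_cases h : z ∈ ball a (1 - ‖a‖)
    · left; rwa [cell, one_mul]
    · exact Or.inr ⟨hz, h⟩
  rw [lintegral_eq_disc]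
  refine (lintegral_mono_set hsplit).trans ((lintegral_union_le _ _ _).trans ?_)
  have h1 : ∫⁻ z in cell a 1, ‖B a z‖ₑ ^ 2 ∂(weightMeasure u) ≤
      ENNReal.ofReal (((1 - ‖a‖) ^ 4)⁻¹ * (weightMeasure u).real (cell a 1)) := by
    rw [ENNReal.ofReal_mul (by positivity), Measure.real, ENNReal.ofReal_toReal (by finiteness),
      ← setLIntegral_const]
    refine setLIntegral_mono' (measurableSet_cell a 1) fun z hz => enorm_B_sq_le hd ?_
    have hz1 : ‖z‖ < 1 := by simpa using cell_subset_disc ha le_rfl hz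
    exact one_sub_le_norm_one_sub (by nlinarith [norm_nonneg a])
  have h2 : ∫⁻ z in disc \ ball a (1 - ‖a‖), ‖B a z‖ₑ ^ 2 ∂(weightMeasure u) ≤
      ENNReal.ofReal (256 * C * (256 * C + 1) /
        (weightMeasure fun z => (u z)⁻¹).real (window a (1 - ‖a‖))) := by
    obtain ⟨n, hn⟩ := pow_unbounded_of_one_lt (1 - ‖a‖)⁻¹ (show (1 : ℝ) < 4 by norm_num)
    have hn' : 1 < 4 ^ (n + 1) * (1 - ‖a‖) := by
      rw [inv_lt_iff_one_lt_mul₀ hd] at hn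
      rw [pow_succ]
      nlinarith
    refine le_trans ?_ (lintegral_tail_le hu hC0 hC ha n _ le_rfl hn')
    refine setLIntegral_mono' (measurableSet_disc.diff measurableSet_ball) fun z hz => ?_
    have hz2 : 1 - ‖a‖ ≤ ‖z - a‖ := by simpa [dist_eq_norm] using hz.2
    exact enorm_B_sq_le (by linarith) (norm_sub_le_norm_one_sub ha hz.1)
  refine (add_le_add h1 h2).trans ?_
  have hs := cell_measure_pos hu.inv ha one_pos le_rfl
  rw [window_eq_cell ha, ← ENNReal.ofReal_add (by positivity) (by positivity)]
  refine ENNReal.ofReal_le_ofReal ?_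
  have h3 := area_sq_le hu (measurableSet_cell a 1)
  rw [area_cell ha zero_le_one le_rfl] at h3
  -- The tail was bounded by `1 / σ(cell)`; Cauchy–Schwarz converts this to `μ(cell) / d⁴`.
  have h4 : 1 / (weightMeasure fun z => (u z)⁻¹).real (cell a 1) ≤
      (weightMeasure u).real (cell a 1) / (1 - ‖a‖) ^ 4 := by
    rw [div_le_div_iff₀ hs (by positivity)]
    calc _ = (1 ^ 2 * (1 - ‖a‖) ^ 2) ^ 2 := by ring
      _ ≤ _ := h3
  calc _ = (weightMeasure u).real (cell a 1) / (1 - ‖a‖) ^ 4 + 256 * C * (256 * C + 1) *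
        (1 / (weightMeasure fun z => (u z)⁻¹).real (cell a 1)) := by ring
    _ ≤ (weightMeasure u).real (cell a 1) / (1 - ‖a‖) ^ 4 + 256 * C * (256 * C + 1) *
        ((weightMeasure u).real (cell a 1) / (1 - ‖a‖) ^ 4) := by gcongr
    _ = _ := by ring

/-! ### The area mean value inequality -/

theorem enorm_le_lintegral_circle {F : ℂ → ℂ} {a : ℂ} {s : ℝ} (hs : 0 < s)
    (hF : DifferentiableOn ℂ F (closedBall a s)) :
    ENNReal.ofReal (2 * Real.pi) * ‖F a‖ₑ ≤
      ∫⁻ θ in Set.Ioo (-Real.pi) Real.pi, ‖F (circleMap a s θ)‖ₑ := by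
  have hpi := Real.pi_pos
  have h1 : Real.circleAverage F a s = F a := by
    refine DiffContOnCl.circleAverage ?_
    rw [abs_of_pos hs]
    exact hF.diffContOnCl_ball subset_rfl
  -- The period is shifted to `(-π, π)`, the angular range of polar coordinates.
  rw [Real.circleAverage_eq_integral_add (-Real.pi),
    intervalIntegral.integral_comp_add_right (fun θ => F (circleMap a s θ))] at h1
  have e1 : 0 + -Real.pi = -Real.pi := by ring
  have e2 : 2 * Real.pi + -Real.pi = Real.pi := by ring
  rw [e1, e2, intervalIntegral.integral_of_le (by linarith), integral_Ioc_eq_integral_Ioo] at h1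
  have h2 : ((2 * Real.pi : ℝ) : ℂ) * F a =
      ∫ θ in Set.Ioo (-Real.pi) Real.pi, F (circleMap a s θ) := by
    rw [← h1, Complex.real_smul, ← mul_assoc, ← Complex.ofReal_mul, mul_inv_cancel₀ (by positivity),
      Complex.ofReal_one, one_mul]
  have h3 := enorm_integral_le_lintegral_enorm (μ := volume.restrict (Set.Ioo (-Real.pi) Real.pi))
    (fun θ => F (circleMap a s θ))
  rw [← h2, enorm_mul] at h3
  convert h3 using 2
  rw [← ofReal_norm, Complex.norm_real, Real.norm_of_nonneg (by positivity)]

theorem lintegral_Ioo_ofReal {r : ℝ} (hr : 0 ≤ r) :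
    ∫⁻ s in Set.Ioo 0 r, ENNReal.ofReal s = ENNReal.ofReal (r ^ 2 / 2) := by
  rw [← ofReal_integral_eq_lintegral_ofReal]
  · rw [← integral_Ioc_eq_integral_Ioo, ← intervalIntegral.integral_of_le hr, integral_id]
    simp
  · exact (continuous_id.integrableOn_Icc).mono_set Set.Ioo_subset_Icc_self
  · filter_upwards [ae_restrict_mem measurableSet_Ioo] with s hs using hs.1.le

theorem measurable_indicator_enorm {F : ℂ → ℂ} {U : Set ℂ} (hU : MeasurableSet U)
    (hF : ContinuousOn F U) : Measurable (U.indicator fun z => ‖F z‖ₑ) := by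
  classical
  have h : Measurable (U.piecewise F 0) := hF.measurable_piecewise continuousOn_const hU
  have e : (U.indicator fun z => ‖F z‖ₑ) = fun z => ‖U.piecewise F 0 z‖ₑ := by
    ext z
    by_cases hz : z ∈ U <;> simp [hz]
  rw [e]
  exact h.enorm

/-- The circle inequality is integrated against `s ds` over `(0, r)`, with `2π · r²/2 = π r²`.
Extended nonnegative integrals make integrability of `F` on the open ball unnecessary. -/
theorem enorm_mul_le_lintegral_volume {F : ℂ → ℂ} {a : ℂ} {r : ℝ} (hr : 0 < r)
    (hF : DifferentiableOn ℂ F (ball a r)) :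
    ENNReal.ofReal (Real.pi * r ^ 2) * ‖F a‖ₑ ≤ ∫⁻ z in ball a r, ‖F z‖ₑ := by
  have hpi := Real.pi_pos
  set g : ℂ → ℝ≥0∞ := (ball a r).indicator fun z => ‖F z‖ₑ with hg
  have hgm : Measurable g := measurable_indicator_enorm measurableSet_ball hF.continuousOn
  rw [← lintegral_indicator measurableSet_ball, ← hg, ← lintegral_add_left_eq_self g a,
    ← Complex.lintegral_comp_polarCoord_symm, polarCoord_target, Measure.volume_eq_prod]
  have hcirc : ∀ s θ : ℝ, a + Complex.polarCoord.symm (s, θ) = circleMap a s θ := by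
    intro s θ
    rw [Complex.polarCoord_symm_apply, circleMap, Complex.exp_mul_I, Complex.ofReal_cos,
      Complex.ofReal_sin]
  have hm : Measurable fun p : ℝ × ℝ => ENNReal.ofReal p.1 • g (a + Complex.polarCoord.symm p) := by
    have hc : Continuous fun p : ℝ × ℝ => a + Complex.polarCoord.symm p := by
      simp only [Complex.polarCoord_symm_apply]
      fun_prop
    exact (measurable_fst.ennreal_ofReal).smul (hgm.comp hc.measurable)
  rw [setLIntegral_prod _ hm.aemeasurable]
  calc ENNReal.ofReal (Real.pi * r ^ 2) * ‖F a‖ₑ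
      = (∫⁻ s in Set.Ioo 0 r, ENNReal.ofReal s) * (ENNReal.ofReal (2 * Real.pi) * ‖F a‖ₑ) := by
        rw [lintegral_Ioo_ofReal hr.le, ← mul_assoc, ← ENNReal.ofReal_mul (by positivity)]
        congr 2; ring
    _ = ∫⁻ s in Set.Ioo 0 r, ENNReal.ofReal s * (ENNReal.ofReal (2 * Real.pi) * ‖F a‖ₑ) :=
        (lintegral_mul_const _ (by fun_prop)).symm
    _ ≤ ∫⁻ s in Set.Ioo 0 r, ∫⁻ θ in Set.Ioo (-Real.pi) Real.pi,
          ENNReal.ofReal (s, θ).1 • g (a + Complex.polarCoord.symm (s, θ)) := by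
        refine setLIntegral_mono' measurableSet_Ioo fun s hs => ?_
        simp only [hcirc, smul_eq_mul]
        rw [lintegral_const_mul']
        · gcongr
          refine (enorm_le_lintegral_circle hs.1
            (hF.mono (closedBall_subset_ball hs.2))).trans (le_of_eq ?_)
          refine lintegral_congr fun θ => ?_
          rw [hg, Set.indicator_of_mem]
          exact closedBall_subset_ball hs.2 (circleMap_mem_closedBall a hs.1.le θ)
        · exact ENNReal.ofReal_ne_top
    _ ≤ _ := lintegral_mono_set Set.Ioo_subset_Ioi_self

theorem enorm_mul_le_lintegral_area {F : ℂ → ℂ} {a : ℂ} {r : ℝ} (hr : 0 < r)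
    (h : ball a r ⊆ disc) (hF : DifferentiableOn ℂ F disc) :
    ENNReal.ofReal (r ^ 2) * ‖F a‖ₑ ≤ ∫⁻ z in ball a r, ‖F z‖ₑ ∂area := by
  have h1 := enorm_mul_le_lintegral_volume hr (hF.mono h)
  have h2 : area.restrict (ball a r) = (ENNReal.ofReal Real.pi)⁻¹ • volume.restrict (ball a r) := by
    rw [area, Measure.restrict_smul, Measure.restrict_restrict measurableSet_ball,
      Set.inter_eq_self_of_subset_left h]
  rw [h2, lintegral_smul_measure, smul_eq_mul]
  refine le_trans (le_of_eq ?_) (mul_le_mul_right h1 _)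
  rw [ENNReal.ofReal_mul Real.pi_pos.le, mul_assoc, ← mul_assoc (_⁻¹ : ℝ≥0∞),
    ENNReal.inv_mul_cancel (by simp [Real.pi_pos]) (by simp), one_mul]

/-- The pointwise estimate for analytic functions in terms of the weight. -/
theorem enorm_sq_mul_le {u : ℂ → ℝ} (hu : IsB2Weight u) {F : ℂ → ℂ}
    (hF : DifferentiableOn ℂ F disc) {a : ℂ} (ha : a ∈ disc) {ε : ℝ} (h0 : 0 < ε) (h1 : ε ≤ 1) :
    ENNReal.ofReal (ε ^ 4 * (1 - ‖a‖) ^ 4) * ‖F a‖ₑ ^ 2 ≤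
      (∫⁻ z in cell a ε, ‖F z‖ₑ ^ 2 ∂(weightMeasure u)) *
        weightMeasure (fun z => (u z)⁻¹) (cell a ε) := by
  have ha1 : ‖a‖ < 1 := by simpa using ha
  have hd : 0 < 1 - ‖a‖ := by linarith
  have hm : AEMeasurable (fun z => ‖F z‖ₑ) (area.restrict (cell a ε)) :=
    ((hF.continuousOn.mono (cell_subset_disc ha h1)).aemeasurable (measurableSet_cell a ε)).enorm
  refine le_trans (le_of_eq ?_) (lintegral_sq_le hu (measurableSet_cell a ε) hm |> le_trans
    (pow_le_pow_left₀ zero_le (enorm_mul_le_lintegral_area (mul_pos h0 hd)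
      (cell_subset_disc ha h1) hF) 2))
  rw [mul_pow, ← ENNReal.ofReal_pow (by positivity)]
  congr 2; ring

/-! ### The space `A²(u)` -/

theorem aestronglyMeasurable_of_differentiableOn {μ : Measure ℂ} (hμ : μ discᶜ = 0) {F : ℂ → ℂ}
    (hF : DifferentiableOn ℂ F disc) : AEStronglyMeasurable F μ := by
  have h : μ.restrict disc = μ := Measure.restrict_eq_self_of_ae_mem hμ
  rw [← h]
  exact hF.continuousOn.aestronglyMeasurable measurableSet_ball

theorem eLpNorm_two_sq (μ : Measure ℂ) (F : ℂ → ℂ) : eLpNorm F 2 μ ^ 2 = ∫⁻ z, ‖F z‖ₑ ^ 2 ∂μ := by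
  have h := eLpNorm_nnreal_pow_eq_lintegral (μ := μ) (f := F) (p := 2) two_ne_zero
  simpa using h

theorem memLp_two_of_differentiableOn {μ : Measure ℂ} (hμ : μ discᶜ = 0) {F : ℂ → ℂ}
    (hF : DifferentiableOn ℂ F disc) (h : ∫⁻ z, ‖F z‖ₑ ^ 2 ∂μ < ∞) : MemLp F 2 μ := by
  refine ⟨aestronglyMeasurable_of_differentiableOn hμ hF, ?_⟩
  rw [← eLpNorm_two_sq] at h
  exact (ENNReal.pow_lt_top_iff.1 h).resolve_right two_ne_zero

variable {u : ℂ → ℝ}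

theorem enorm_sq_eq (f : bergmanSpace u) :
    ‖f‖ₑ ^ 2 = ∫⁻ z, ‖holo f z‖ₑ ^ 2 ∂(weightMeasure u) := by
  have h : ‖f‖ₑ = eLpNorm (f : Lp ℂ 2 (weightMeasure u)) 2 (weightMeasure u) := Lp.enorm_def _
  rw [h, eLpNorm_congr_ae (holo_ae_eq f), eLpNorm_two_sq]

theorem exists_holo_eqOn (hu : IsB2Weight u) {F : ℂ → ℂ} (hF : DifferentiableOn ℂ F disc)
    (h : ∫⁻ z, ‖F z‖ₑ ^ 2 ∂(weightMeasure u) < ∞) :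
    ∃ f : bergmanSpace u, Set.EqOn (holo f) F disc := by
  have hm := memLp_two_of_differentiableOn (weightMeasure_compl_disc u) hF h
  exact ⟨⟨hm.toLp F, F, hF, hm.coeFn_toLp⟩, holo_eqOn hu _ hF hm.coeFn_toLp⟩

theorem holo_add (hu : IsB2Weight u) (f g : bergmanSpace u) :
    Set.EqOn (holo (f + g)) (holo f + holo g) disc :=
  holo_eqOn hu _ ((holo_differentiableOn f).add (holo_differentiableOn g))
    ((Lp.coeFn_add _ _).trans ((holo_ae_eq f).add (holo_ae_eq g)))

theorem holo_smul (hu : IsB2Weight u) (c : ℂ) (f : bergmanSpace u) :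
    Set.EqOn (holo (c • f)) (c • holo f) disc :=
  holo_eqOn hu _ ((holo_differentiableOn f).const_smul c)
    ((Lp.coeFn_smul _ _).trans ((holo_ae_eq f).const_smul c))

theorem holo_sub (hu : IsB2Weight u) (f g : bergmanSpace u) :
    Set.EqOn (holo (f - g)) (holo f - holo g) disc :=
  holo_eqOn hu _ ((holo_differentiableOn f).sub (holo_differentiableOn g))
    ((Lp.coeFn_sub _ _).trans ((holo_ae_eq f).sub (holo_ae_eq g)))

/-- Point evaluations are bounded, uniformly on compact subsets of the disc. -/
theorem exists_norm_holo_le (hu : IsB2Weight u) {r : ℝ} (hr : r < 1) :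
    ∃ M : ℝ, 0 < M ∧ ∀ f : bergmanSpace u, ∀ z ∈ closedBall (0 : ℂ) r, ‖holo f z‖ ≤ M * ‖f‖ := by
  have := isFiniteMeasure_weightMeasure hu.inv
  set s := (weightMeasure fun z => (u z)⁻¹).real Set.univ
  have hs : 0 ≤ s := measureReal_nonneg
  refine ⟨√((s + 1) / (1 - r) ^ 4), Real.sqrt_pos.2 (by have : 0 < 1 - r := by linarith
                                                        positivity), fun f z hz => ?_⟩
  rw [mem_closedBall, dist_zero_right] at hz
  have hzd : z ∈ disc := by simpa using hz.trans_lt hr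
  have h := enorm_sq_mul_le hu (holo_differentiableOn f) hzd one_pos le_rfl
  have h2 : ENNReal.ofReal ((1 - r) ^ 4) * ‖holo f z‖ₑ ^ 2 ≤
      ‖f‖ₑ ^ 2 * weightMeasure (fun z => (u z)⁻¹) Set.univ := by
    rw [enorm_sq_eq]
    refine le_trans ?_ (h.trans (mul_le_mul' (setLIntegral_le_lintegral _ _)
      (measure_mono (Set.subset_univ _))))
    gcongr
    have : 0 ≤ 1 - r := by linarith
    rw [one_pow, one_mul]
    gcongr
  have h3 := ENNReal.toReal_mono (by finiteness) h2
  have hr' : 0 < 1 - r := by linarith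
  simp only [ENNReal.toReal_mul, ENNReal.toReal_pow, toReal_enorm] at h3
  rw [ENNReal.toReal_ofReal (by positivity)] at h3
  refine le_of_sq_le_sq ?_ (by positivity)
  rw [mul_pow, Real.sq_sqrt (by positivity), div_mul_eq_mul_div, le_div_iff₀ (by positivity)]
  have h4 : (1 - r) ^ 4 * ‖holo f z‖ ^ 2 ≤ ‖f‖ ^ 2 * s := h3
  nlinarith [sq_nonneg ‖f‖]

theorem exists_norm_holo_le_at (hu : IsB2Weight u) {a : ℂ} (ha : a ∈ disc) :
    ∃ M : ℝ, ∀ f : bergmanSpace u, ‖holo f a‖ ≤ M * ‖f‖ := by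
  obtain ⟨M, -, hM⟩ := exists_norm_holo_le hu (r := ‖a‖) (by simpa using ha)
  exact ⟨M, fun f => hM f a (by simp)⟩

/-- Norm convergence forces locally uniform convergence, since point evaluations are locally
uniformly bounded; the limit is analytic and agrees a.e. with the `L²` limit along a subsequence. -/
theorem isClosed_bergmanSpace (hu : IsB2Weight u) :
    IsClosed (bergmanSpace u : Set (Lp ℂ 2 (weightMeasure u))) := by
  refine IsSeqClosed.isClosed fun x y hx hxy => ?_
  set f : ℕ → bergmanSpace u := fun n => ⟨x n, hx n⟩ with hf
  have hcau : CauchySeq f :=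
    Metric.cauchySeq_iff.2 fun ε hε => Metric.cauchySeq_iff.1 hxy.cauchySeq ε hε
  have hlim : ∀ z ∈ disc, ∃ c, Tendsto (fun n => holo (f n) z) atTop (𝓝 c) := by
    intro z hz
    obtain ⟨M, hM⟩ := exists_norm_holo_le_at hu hz
    refine cauchySeq_tendsto_of_complete ?_
    -- The evaluation bound carries no sign for `M`, hence `max M 0`.
    have hM' : ∀ m n, dist (holo (f m) z) (holo (f n) z) ≤ max M 0 * dist (f m) (f n) := by
      intro m n
      rw [dist_eq_norm, dist_eq_norm]
      have := holo_sub hu (f m) (f n) hz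
      rw [Pi.sub_apply] at this
      rw [← this]
      exact (hM _).trans (by gcongr; exact le_max_left _ _)
    rw [Metric.cauchySeq_iff] at hcau ⊢
    intro ε hε
    obtain ⟨N, hN⟩ := hcau (ε / (max M 0 + 1)) (by positivity)
    refine ⟨N, fun m hm n hn => (hM' m n).trans_lt ?_⟩
    have := hN m hm n hn
    rw [lt_div_iff₀ (by positivity)] at this
    nlinarith [dist_nonneg (x := f m) (y := f n)]
  choose! G hG using hlim
  have hGd : DifferentiableOn ℂ G disc := by
    refine TendstoLocallyUniformlyOn.differentiableOn (F := fun n => holo (f n)) (φ := atTop) ?_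
      (Eventually.of_forall fun n => holo_differentiableOn _) isOpen_ball
    rw [tendstoLocallyUniformlyOn_iff_forall_isCompact isOpen_ball]
    intro S hS hSc
    obtain ⟨r, hr1, hr⟩ : ∃ r < 1, S ⊆ closedBall (0 : ℂ) r := by
      obtain ⟨r, hr1, hr⟩ := exists_lt_subset_ball hSc.isClosed hS
      exact ⟨r, hr1, hr.trans ball_subset_closedBall⟩
    obtain ⟨M, hM0, hM⟩ := exists_norm_holo_le hu hr1
    rw [Metric.tendstoUniformlyOn_iff]
    intro ε hε
    rw [Metric.cauchySeq_iff] at hcau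
    obtain ⟨N, hN⟩ := hcau (ε / (2 * M)) (by positivity)
    filter_upwards [eventually_ge_atTop N] with n hn z hz
    have hle : dist (G z) (holo (f n) z) ≤ ε / 2 := by
      refine le_of_tendsto ((hG z (hS hz)).dist tendsto_const_nhds) ?_
      filter_upwards [eventually_ge_atTop N] with m hm
      have h1 := holo_sub hu (f m) (f n) (hS hz)
      rw [Pi.sub_apply] at h1
      rw [dist_eq_norm, ← h1]
      refine (hM _ z (hr hz)).trans ?_
      have h2 := (hN m hm n hn).le
      rw [dist_eq_norm, le_div_iff₀ (by positivity)] at h2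
      linarith
    linarith
  refine ⟨G, hGd, ?_⟩
  obtain ⟨ns, hmono, hns⟩ := (tendstoInMeasure_of_tendsto_Lp hxy).exists_seq_tendsto_ae
  have hall : ∀ᵐ z ∂(weightMeasure u), ∀ n, (x n : ℂ → ℂ) z = holo (f n) z :=
    ae_all_iff.2 fun n => holo_ae_eq (f n)
  filter_upwards [hns, hall, ae_mem_disc u] with z h1 h2 h3
  simp only [h2] at h1
  exact tendsto_nhds_unique h1 ((hG z h3).comp hmono.tendsto_atTop)

/-! ### Reproducing kernels -/

theorem completeSpace_bergmanSpace (hu : IsB2Weight u) : CompleteSpace (bergmanSpace u) :=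
  (isClosed_bergmanSpace hu).completeSpace_coe

/-- Evaluation at a point of the disc, as a continuous linear functional. -/
def evalCLM (hu : IsB2Weight u) {a : ℂ} (ha : a ∈ disc) : bergmanSpace u →L[ℂ] ℂ :=
  LinearMap.mkContinuousOfExistsBound
    { toFun := fun f => holo f a
      map_add' := fun f g => holo_add hu f g ha
      map_smul' := fun c f => holo_smul hu c f ha }
    (exists_norm_holo_le_at hu ha)

/-- Riesz representation of point evaluation on the complete space `A²(u)`; the default branch of
`kernel` is thus never taken on the disc. -/
theorem inner_kernel (hu : IsB2Weight u) {a : ℂ} (ha : a ∈ disc) (f : bergmanSpace u) :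
    @inner ℂ (bergmanSpace u) InnerProductSpace.toInner (kernel u a) f = holo f a := by
  have := completeSpace_bergmanSpace hu
  have h : ∃ K : bergmanSpace u, ∀ f : bergmanSpace u, inner ℂ K f = holo f a :=
    ⟨(InnerProductSpace.toDual ℂ _).symm (evalCLM hu ha),
      fun _ => InnerProductSpace.toDual_symm_apply⟩
  rw [kernel, dif_pos h]
  exact Classical.choose_spec h f

theorem holo_kernel_symm (hu : IsB2Weight u) {a b : ℂ} (ha : a ∈ disc) (hb : b ∈ disc) :
    holo (kernel u b) a = (starRingEnd ℂ) (holo (kernel u a) b) := by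
  rw [← inner_kernel hu ha, ← inner_kernel hu hb, inner_conj_symm]

theorem holo_kernel_self (hu : IsB2Weight u) {a : ℂ} (ha : a ∈ disc) :
    holo (kernel u a) a = ((‖kernel u a‖ ^ 2 : ℝ) : ℂ) := by
  rw [← inner_kernel hu ha, inner_self_eq_norm_sq_to_K]
  norm_cast

theorem norm_holo_le_kernel (hu : IsB2Weight u) {a : ℂ} (ha : a ∈ disc) (f : bergmanSpace u) :
    ‖holo f a‖ ≤ ‖kernel u a‖ * ‖f‖ := by
  rw [← inner_kernel hu ha]
  exact norm_inner_le_norm _ _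

theorem one_sub_ne_zero {a z : ℂ} (ha : a ∈ disc) (hz : z ∈ disc) :
    1 - (starRingEnd ℂ) a * z ≠ 0 := by
  have ha1 : ‖a‖ < 1 := by simpa using ha
  have hz1 : ‖z‖ < 1 := by simpa using hz
  have h := one_sub_le_norm_one_sub (a := a) (z := z) (t := ‖a‖) (by nlinarith [norm_nonneg a])
  rw [← norm_pos_iff]
  linarith

theorem differentiableOn_B {a : ℂ} (ha : a ∈ disc) : DifferentiableOn ℂ (B a) disc := by
  unfold B
  refine DifferentiableOn.div (by fun_prop) (by fun_prop) fun z hz => ?_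
  exact pow_ne_zero 2 (one_sub_ne_zero ha hz)

theorem exists_holo_eq_B (hu : IsB2Weight u) {a : ℂ} (ha : a ∈ disc) :
    ∃ b : bergmanSpace u, Set.EqOn (holo b) (B a) disc := by
  obtain ⟨C, -, hC⟩ := exists_lintegral_B_le hu
  exact exists_holo_eqOn hu (differentiableOn_B ha) ((hC a ha).trans_lt ENNReal.ofReal_lt_top)

theorem enorm_sq_eq_of_eqOn {f : bergmanSpace u} {F : ℂ → ℂ} (h : Set.EqOn (holo f) F disc) :
    ‖f‖ₑ ^ 2 = ∫⁻ z, ‖F z‖ₑ ^ 2 ∂(weightMeasure u) := by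
  rw [enorm_sq_eq]
  refine lintegral_congr_ae ?_
  filter_upwards [ae_mem_disc u] with z hz
  rw [h hz]

theorem enorm_sq_le_ofReal {E : Type*} [SeminormedAddCommGroup E] {x : E} {t : ℝ} (ht : 0 ≤ t)
    (h : ‖x‖ₑ ^ 2 ≤ ENNReal.ofReal t) : ‖x‖ ^ 2 ≤ t := by
  rwa [← ofReal_norm, ← ENNReal.ofReal_pow (norm_nonneg _), ENNReal.ofReal_le_ofReal_iff ht] at h

theorem norm_B_self {a : ℂ} (ha : a ∈ disc) : (4 * (1 - ‖a‖) ^ 2)⁻¹ ≤ ‖B a a‖ := by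
  have ha1 : ‖a‖ < 1 := by simpa using ha
  have h0 := norm_nonneg a
  have e : (1 : ℂ) - (starRingEnd ℂ) a * a = ((1 - ‖a‖ ^ 2 : ℝ) : ℂ) := by
    rw [mul_comm, Complex.mul_conj, Complex.normSq_eq_norm_sq]; push_cast; ring
  rw [B, e, norm_div, norm_one, norm_pow, Complex.norm_real, Real.norm_eq_abs, sq_abs, one_div]
  have h1 : 0 < 1 - ‖a‖ ^ 2 := by nlinarith
  gcongr
  have : 1 - ‖a‖ ^ 2 ≤ 2 * (1 - ‖a‖) := by nlinarith
  calc (1 - ‖a‖ ^ 2) ^ 2 ≤ (2 * (1 - ‖a‖)) ^ 2 := by gcongr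
    _ = _ := by ring

/-- Test `|f(a)| ≤ ‖K_a‖ ‖f‖` on `f = B_a`, for which `|B_a(a)| ≥ 1 / (4 d²)` and `‖B_a‖² ≤ C μ(cell
a 1) / d⁴`. -/
theorem exists_le_norm_kernel (hu : IsB2Weight u) :
    ∃ c : ℝ, 0 < c ∧ ∀ a ∈ disc, c ≤ ‖kernel u a‖ ^ 2 * (weightMeasure u).real (cell a 1) := by
  obtain ⟨C, hC0, hC⟩ := exists_lintegral_B_le hu
  refine ⟨(16 * C)⁻¹, by positivity, fun a ha => ?_⟩
  have ha1 : ‖a‖ < 1 := by simpa using ha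
  have hd : 0 < 1 - ‖a‖ := by linarith
  obtain ⟨b, hb⟩ := exists_holo_eq_B hu ha
  have h1 := hC a ha
  rw [← enorm_sq_eq_of_eqOn hb] at h1
  have hm := (cell_measure_pos hu ha one_pos le_rfl).le
  have h2 := enorm_sq_le_ofReal (by positivity) h1
  have h3 := norm_holo_le_kernel hu ha b
  rw [hb ha] at h3
  have h4 := pow_le_pow_left₀ (by positivity) ((norm_B_self ha).trans h3) 2
  rw [mul_pow] at h4
  set m := (weightMeasure u).real (cell a 1)
  have h5 : ((4 * (1 - ‖a‖) ^ 2)⁻¹) ^ 2 ≤ ‖kernel u a‖ ^ 2 * (C * m / (1 - ‖a‖) ^ 4) :=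
    h4.trans (by gcongr)
  rw [inv_le_iff_one_le_mul₀ (by positivity)]
  rw [inv_pow, inv_le_iff_one_le_mul₀ (by positivity)] at h5
  refine h5.trans (le_of_eq ?_)
  field_simp
  ring

/-- In the weighted mean value inequality, `B₂` trades the factor `σ(cell a ε)` for a multiple of
`d⁴ / μ(cell a 1)`. -/
theorem enorm_sq_mul_cell_le (hu : IsB2Weight u) {C : ℝ} (hC : IsWindowConst u C)
    {F : ℂ → ℂ} (hF : DifferentiableOn ℂ F disc) {a : ℂ} (ha : a ∈ disc) {ε : ℝ} (h0 : 0 < ε)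
    (h1 : ε ≤ 1) :
    ‖F a‖ₑ ^ 2 * weightMeasure u (cell a 1) ≤
      ENNReal.ofReal (C / ε ^ 4) * ∫⁻ z in cell a ε, ‖F z‖ₑ ^ 2 ∂(weightMeasure u) := by
  have := isFiniteMeasure_weightMeasure hu
  have := isFiniteMeasure_weightMeasure hu.inv
  have ha1 : ‖a‖ < 1 := by simpa using ha
  have hd : 0 < 1 - ‖a‖ := by linarith
  have h := enorm_sq_mul_le hu hF ha h0 h1
  have hw := hC a ha _ le_rfl
  rw [window_eq_cell ha] at hw
  have hsub : cell a ε ⊆ cell a 1 := ball_subset_ball (by nlinarith)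
  set σ := weightMeasure fun z => (u z)⁻¹
  have h2 : σ (cell a ε) * weightMeasure u (cell a 1) ≤ ENNReal.ofReal (C * (1 - ‖a‖) ^ 4) := by
    refine (mul_le_mul_left (measure_mono hsub) _).trans ?_
    rw [← ENNReal.ofReal_toReal (show σ (cell a 1) * weightMeasure u (cell a 1) ≠ ∞ by finiteness),
      ENNReal.toReal_mul, mul_comm]
    exact ENNReal.ofReal_le_ofReal hw
  set I := ∫⁻ z in cell a ε, ‖F z‖ₑ ^ 2 ∂(weightMeasure u)
  have hne : ENNReal.ofReal (ε ^ 4 * (1 - ‖a‖) ^ 4) ≠ 0 := by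
    rw [Ne, ENNReal.ofReal_eq_zero, not_le]; positivity
  refine (ENNReal.mul_le_mul_iff_right hne ENNReal.ofReal_ne_top).1 ?_
  calc _ = (ENNReal.ofReal (ε ^ 4 * (1 - ‖a‖) ^ 4) * ‖F a‖ₑ ^ 2) * weightMeasure u (cell a 1) := by
        ring
    _ ≤ I * σ (cell a ε) * weightMeasure u (cell a 1) := by gcongr
    _ = I * (σ (cell a ε) * weightMeasure u (cell a 1)) := by ring
    _ ≤ I * ENNReal.ofReal (C * (1 - ‖a‖) ^ 4) := by gcongr
    _ = _ := by
      rw [← mul_assoc, ← ENNReal.ofReal_mul (by positivity), mul_comm]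
      congr 2
      field_simp

/-- Applied to `K_a` itself, where `K_a(a) = ‖K_a‖²`, the pointwise estimate reads `‖K_a‖⁴ μ(cell a
1) ≤ C ‖K_a‖²`. -/
theorem exists_norm_kernel_le (hu : IsB2Weight u) :
    ∃ C : ℝ, 0 < C ∧ ∀ a ∈ disc, ‖kernel u a‖ ^ 2 * (weightMeasure u).real (cell a 1) ≤ C := by
  have := isFiniteMeasure_weightMeasure hu
  obtain ⟨C, hC0, hC⟩ := exists_window_bound hu
  obtain ⟨c, hc0, hc⟩ := exists_le_norm_kernel hu
  refine ⟨C, hC0, fun a ha => ?_⟩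
  have h := enorm_sq_mul_cell_le hu hC (holo_differentiableOn (kernel u a)) ha one_pos le_rfl
  have h2 : ‖holo (kernel u a) a‖ₑ ^ 2 * weightMeasure u (cell a 1) ≤
      ENNReal.ofReal C * ‖kernel u a‖ₑ ^ 2 := by
    rw [enorm_sq_eq]
    refine h.trans ?_
    rw [one_pow, div_one]
    gcongr
    exact Measure.restrict_le_self
  have h3 := ENNReal.toReal_mono (by finiteness) h2
  simp only [ENNReal.toReal_mul, ENNReal.toReal_pow, toReal_enorm,
    ENNReal.toReal_ofReal hC0.le] at h3
  rw [holo_kernel_self hu ha, Complex.norm_real, Real.norm_of_nonneg (by positivity)] at h3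
  have hpos : 0 < ‖kernel u a‖ ^ 2 :=
    pos_of_mul_pos_left (hc0.trans_le (hc a ha)) measureReal_nonneg
  refine le_of_mul_le_mul_right ?_ hpos
  refine le_trans (le_of_eq ?_) h3
  rw [Measure.real]; ring

/-- Near the diagonal the reproducing kernel is comparable to its value on the diagonal. -/
theorem exists_kernel_near_diagonal (hu : IsB2Weight u) :
    ∃ ε : ℝ, 0 < ε ∧ ε ≤ 1 / 2 ∧ ∀ a ∈ disc, ∀ w ∈ cell a ε,
      ‖kernel u a‖ ^ 2 / 2 ≤ ‖holo (kernel u a) w‖ := by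
  obtain ⟨W, hW0, hW⟩ := exists_window_bound hu
  obtain ⟨c, hc0, hc⟩ := exists_le_norm_kernel hu
  obtain ⟨C, hC0, hC⟩ := exists_norm_kernel_le hu
  set M := C * (4096 * W + 1) with hM
  have hM0 : 0 < M := by positivity
  -- With `|K_a| ≤ M / m` on the half cell, the Schwarz lemma bounds the oscillation on `cell a ε`
  -- by `4 M ε / m ≤ c / (2 m) ≤ ‖K_a‖² / 2`.
  refine ⟨min (1 / 2) (c / (8 * M)), by positivity, min_le_left _ _, fun a ha w hw => ?_⟩
  have ha1 : ‖a‖ < 1 := by simpa using ha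
  have hd : 0 < 1 - ‖a‖ := by linarith
  have hm := cell_measure_pos hu ha one_pos le_rfl
  set m := (weightMeasure u).real (cell a 1)
  have hbound : ∀ z ∈ cell a (1 / 2), ‖holo (kernel u a) z‖ ≤ M / m := by
    intro z hz
    have hzd := cell_subset_disc ha (by norm_num) hz
    have h1 := norm_holo_le_kernel hu hzd (kernel u a)
    have h2 := hC a ha
    have h3 := hC z hzd
    have h4 := (cell_comparable hu hW ha hz).1
    have h5 : ‖kernel u z‖ ^ 2 * m ≤ 4096 * W * C := by
      calc _ ≤ ‖kernel u z‖ ^ 2 * (4096 * W * (weightMeasure u).real (cell z 1)) := by gcongr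
        _ = 4096 * W * (‖kernel u z‖ ^ 2 * (weightMeasure u).real (cell z 1)) := by ring
        _ ≤ _ := by gcongr
    refine h1.trans ?_
    rw [le_div_iff₀ hm]
    have h6 : ‖kernel u z‖ * ‖kernel u a‖ ≤ (‖kernel u z‖ ^ 2 + ‖kernel u a‖ ^ 2) / 2 := by
      nlinarith [sq_nonneg (‖kernel u z‖ - ‖kernel u a‖)]
    calc _ ≤ (‖kernel u z‖ ^ 2 + ‖kernel u a‖ ^ 2) / 2 * m := by gcongr
      _ ≤ M := by
        have : 0 < W * C := by positivity
        rw [hM]; linarith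
  have hself : holo (kernel u a) a = ((‖kernel u a‖ ^ 2 : ℝ) : ℂ) := holo_kernel_self hu ha
  have haa : a ∈ cell a (1 / 2) := mem_ball_self (by positivity)
  have hmaps : Set.MapsTo (holo (kernel u a)) (ball a (1 / 2 * (1 - ‖a‖)))
      (closedBall (holo (kernel u a) a) (2 * (M / m))) := by
    intro z hz
    rw [mem_closedBall, dist_eq_norm]
    refine (norm_sub_le _ _).trans ?_
    linarith [hbound z hz, hbound a haa]
  have hw' : w ∈ ball a (1 / 2 * (1 - ‖a‖)) :=
    ball_subset_ball (by gcongr; exact min_le_left _ _) hw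
  have hschwarz := Complex.dist_le_div_mul_dist_of_mapsTo_ball
    ((holo_differentiableOn (kernel u a)).mono (cell_subset_disc ha (by norm_num))) hmaps hw'
  have hdist : dist w a ≤ c / (8 * M) * (1 - ‖a‖) := by
    have := (mem_ball.1 hw).le
    exact this.trans (by gcongr; exact min_le_right _ _)
  have h7 : dist (holo (kernel u a) w) (holo (kernel u a) a) ≤ ‖kernel u a‖ ^ 2 / 2 := by
    calc _ ≤ 2 * (M / m) / (1 / 2 * (1 - ‖a‖)) * (c / (8 * M) * (1 - ‖a‖)) :=
          hschwarz.trans (by gcongr)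
      _ = c / m / 2 := by field_simp; ring
      _ ≤ _ := by
        gcongr
        rw [div_le_iff₀ hm]
        exact hc a ha
  rw [dist_eq_norm, norm_sub_rev, hself] at h7
  have h8 := norm_sub_norm_le ((‖kernel u a‖ ^ 2 : ℝ) : ℂ) (holo (kernel u a) w)
  rw [Complex.norm_real, Real.norm_of_nonneg (by positivity)] at h8
  linarith

/-! ### Compact operators -/

section Compact

variable {H F : Type*} [NormedAddCommGroup H] [InnerProductSpace ℂ H]

/-- An operator that is dominated, up to small multiples of the norm, by operators into
finite-dimensional spaces is compact. -/
theorem isCompactOperator_of_norm_le [NormedAddCommGroup F] [NormedSpace ℂ F] [CompleteSpace F]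
    (i : H →L[ℂ] F)
    (h : ∀ ε > 0, ∃ (n : ℕ) (T : H →L[ℂ] (Fin n → ℂ)), ∀ x, ‖i x‖ ≤ ‖T x‖ + ε * ‖x‖) :
    IsCompactOperator i := by
  refine (isCompactOperator_iff_isCompact_closure_image_closedBall (i : H →ₗ[ℂ] F) one_pos).2 ?_
  refine TotallyBounded.isCompact_of_isClosed (TotallyBounded.closure ?_) isClosed_closure
  rw [Metric.totallyBounded_iff]
  intro ε hε
  -- Two points of the unit ball differ by at most 2 in norm, so the error term costs at most `ε /
  -- 2`; the net in the finite-dimensional image costs the other half.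
  obtain ⟨n, T, hT⟩ := h (ε / 4) (by positivity)
  have htb : TotallyBounded (T '' closedBall 0 1) :=
    (T.lipschitz.isBounded_image isBounded_closedBall).isCompact_closure.totallyBounded.subset
      subset_closure
  obtain ⟨t, hts, htf, hcov⟩ := totallyBounded_iff_subset.1 htb _
    (Metric.dist_mem_uniformity (show 0 < ε / 2 by positivity))
  choose! g hg using fun y (hy : y ∈ t) => hts hy
  refine ⟨(fun y => i (g y)) '' t, htf.image _, ?_⟩
  rintro _ ⟨x, hx, rfl⟩
  obtain ⟨y, hy, hxy⟩ := Set.mem_iUnion₂.1 (hcov (Set.mem_image_of_mem T hx))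
  refine Set.mem_iUnion₂.2 ⟨i (g y), Set.mem_image_of_mem _ hy, ?_⟩
  obtain ⟨hg1, hg2⟩ := hg y hy
  have hxy' : dist (T x) y < ε / 2 := hxy
  rw [mem_closedBall, dist_zero_right] at hx hg1
  rw [mem_ball, dist_eq_norm]
  change ‖i x - i (g y)‖ < ε
  rw [← map_sub]
  refine (hT _).trans_lt ?_
  rw [map_sub, hg2, ← dist_eq_norm]
  have := norm_sub_le x (g y)
  nlinarith

/-- A compact operator maps bounded weakly null families to null families. -/
theorem tendsto_norm_of_isCompactOperator [CompleteSpace H] [NormedAddCommGroup F]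
    [InnerProductSpace ℂ F] [CompleteSpace F] {T : H →L[ℂ] F} (hT : IsCompactOperator T)
    {ι : Type*} {l : Filter ι} {x : ι → H} (hx : ∀ᶠ a in l, ‖x a‖ ≤ 1)
    (hw : ∀ y : H, Tendsto (fun a => inner ℂ y (x a)) l (𝓝 0)) :
    Tendsto (fun a => ‖T (x a)‖) l (𝓝 0) := by
  -- Along each ultrafilter compactness supplies a norm limit `y` of `T (x a)`, and `⟨y, T (x a)⟩ =
  -- ⟨T* y, x a⟩ → 0` forces `⟨y, y⟩ = 0`.
  rw [tendsto_iff_ultrafilter]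
  intro g hg
  have hK := (isCompactOperator_iff_isCompact_closure_image_closedBall (T : H →ₗ[ℂ] F)
    one_pos).1 hT
  have hmem : ∀ᶠ a in (g : Filter ι), T (x a) ∈ closure (T '' closedBall 0 1) := by
    filter_upwards [hg hx] with a ha
    exact subset_closure (Set.mem_image_of_mem _ (by simpa using ha))
  obtain ⟨y, -, hy⟩ := hK.ultrafilter_le_nhds (g.map fun a => T (x a)) (by
    rw [le_principal_iff]; exact hmem)
  have hy' : Tendsto (fun a => T (x a)) g (𝓝 y) := hy
  have h1 : Tendsto (fun a => inner ℂ y (T (x a))) g (𝓝 (inner ℂ y y)) :=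
    tendsto_const_nhds.inner hy'
  have h2 : Tendsto (fun a => inner ℂ y (T (x a))) g (𝓝 0) := by
    have := (hw (ContinuousLinearMap.adjoint T y)).mono_left hg
    simpa only [ContinuousLinearMap.adjoint_inner_left] using this
  have h3 : y = 0 := inner_self_eq_zero.1 (tendsto_nhds_unique h1 h2)
  rw [h3] at hy'
  simpa using hy'.norm

end Compact

/-! ### Vanishing conditions -/

variable {ν : Measure ℂ}

/-- The filter of points of the disc that approach the unit circle. -/
def toCircle : Filter ℂ := comap (fun a : ℂ => ‖a‖) (𝓝[<] 1)

theorem eventually_toCircle {p : ℂ → Prop} :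
    (∀ᶠ a in toCircle, p a) ↔ ∃ r < 1, ∀ a ∈ disc, r < ‖a‖ → p a := by
  rw [toCircle, ((nhdsLT_basis (1 : ℝ)).comap _).eventually_iff]
  refine exists_congr fun r => and_congr_right fun _ => ?_
  simp only [Set.mem_preimage, Set.mem_Ioo, mem_ball_zero_iff]
  exact ⟨fun h a h1 h2 => h ⟨h2, h1⟩, fun h a h1 => h a h1.2 h1.1⟩

theorem eventually_mem_disc : ∀ᶠ a in toCircle, a ∈ disc :=
  eventually_toCircle.2 ⟨0, one_pos, fun _ h _ => h⟩

theorem tendsto_norm_toCircle : Tendsto (fun a : ℂ => ‖a‖) toCircle (𝓝 1) :=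
  tendsto_comap.mono_right nhdsWithin_le_nhds

theorem tendsto_weightMeasure_cell (hu : IsB2Weight u) :
    Tendsto (fun a => weightMeasure u (cell a 1)) toCircle (𝓝 0) := by
  have h1 : Tendsto (fun a => area (cell a 1)) toCircle (𝓝 0) := by
    have h2 : Tendsto (fun a : ℂ => ENNReal.ofReal (1 - ‖a‖) ^ 2) toCircle (𝓝 0) := by
      have h3 := (ENNReal.continuous_ofReal.tendsto _).comp
        (tendsto_norm_toCircle.const_sub (1 : ℝ))
      have h4 := ENNReal.Tendsto.pow (n := 2) h3
      simpa using h4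
    refine tendsto_of_tendsto_of_tendsto_of_le_of_le tendsto_const_nhds h2
      (fun _ => zero_le) fun a => ?_
    have := (measure_mono ball_subset_closedBall).trans (area_closedBall_le a (1 * (1 - ‖a‖)))
    simpa only [cell, one_mul] using this
  have h2 : ∫⁻ z, ENNReal.ofReal (u z) ∂area ≠ ∞ := by
    have := isFiniteMeasure_weightMeasure hu
    rw [← setLIntegral_univ, ← weightMeasure_apply MeasurableSet.univ]
    finiteness
  have h3 := tendsto_setLIntegral_zero h2 h1
  refine h3.congr fun a => ?_
  rw [weightMeasure_apply (measurableSet_cell a 1)]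

/-- The cells of a fixed size have finite `ν`-measure, which is small compared to their weight near
the unit circle. -/
def VanishingOnCells (u : ℂ → ℝ) (ν : Measure ℂ) : Prop :=
  ∃ ε : ℝ, 0 < ε ∧ ε ≤ 1 / 2 ∧ (∀ a ∈ disc, ν (cell a ε) < ∞) ∧
    ∀ δ : ℝ, 0 < δ → ∀ᶠ a in toCircle, ν (cell a ε) ≤ ENNReal.ofReal δ * weightMeasure u (cell a 1)

/-- Uniform smallness near the unit circle of the `L²(ν)`-mass of functions in `A²(u)`. -/
def VanishingTails (u : ℂ → ℝ) (ν : Measure ℂ) : Prop :=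
  (∀ r : ℝ, r < 1 → ν (closedBall 0 r) < ∞) ∧
    ∀ δ : ℝ, 0 < δ → ∃ r < 1, ∀ F : ℂ → ℂ, DifferentiableOn ℂ F disc →
      ∫⁻ z in (closedBall 0 r)ᶜ, ‖F z‖ₑ ^ 2 ∂ν ≤
        ENNReal.ofReal δ * ∫⁻ z, ‖F z‖ₑ ^ 2 ∂(weightMeasure u)

/-! ### Toeplitz operators, Carleson inclusions and the local condition -/

/-- The operator is `i* i`: reproducing gives `(i* i f)(z) = ⟨i K_z, i f⟩`, and Hermitian symmetry
of the kernel makes this the Toeplitz integral. It converges absolutely as a product of two `L²(ν)`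
functions. -/
theorem IsVanishingCarleson.toeplitzCompact (hu : IsB2Weight u) (hν : ν discᶜ = 0)
    (h : IsVanishingCarleson u ν) : ToeplitzCompact u ν Set.univ := by
  have := completeSpace_bergmanSpace hu
  obtain ⟨i, hi, hc⟩ := h
  refine ⟨(ContinuousLinearMap.adjoint i).comp i, fun f _ z hz => ?_,
    hc.clm_comp (ContinuousLinearMap.adjoint i)⟩
  have hd : ∀ᵐ w ∂ν, w ∈ disc := hν
  have hae : (fun w => inner ℂ ((i (kernel u z) : ℂ → ℂ) w) ((i f : ℂ → ℂ) w)) =ᵐ[ν]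
      fun w => K u z w * holo f w := by
    filter_upwards [hi f, hi (kernel u z), hd] with w h1 h2 hw
    rw [h1, h2, K, holo_kernel_symm hu hz hw, RCLike.inner_apply, mul_comm]
  refine ⟨(L2.integrable_inner (𝕜 := ℂ) (i (kernel u z)) (i f)).congr hae, ?_⟩
  rw [← integral_congr_ae hae, ← inner_kernel hu hz, ContinuousLinearMap.comp_apply,
    ContinuousLinearMap.adjoint_inner_right]
  exact L2.inner_def _ _

/-- The normalized reproducing kernels converge weakly to zero at the unit circle. -/
theorem tendsto_inner_kernel (hu : IsB2Weight u) (f : bergmanSpace u) :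
    Tendsto (fun a => ‖holo f a‖ / ‖kernel u a‖) toCircle (𝓝 0) := by
  have := isFiniteMeasure_weightMeasure hu
  obtain ⟨W, hW0, hW⟩ := exists_window_bound hu
  obtain ⟨c, hc0, hc⟩ := exists_le_norm_kernel hu
  have hfin : ∫⁻ z, ‖holo f z‖ₑ ^ 2 ∂(weightMeasure u) ≠ ∞ := by
    rw [← enorm_sq_eq]; finiteness
  have h1 := tendsto_setLIntegral_zero hfin (tendsto_weightMeasure_cell hu)
  have h2 := (ENNReal.tendsto_toReal ENNReal.zero_ne_top).comp h1
  -- The local estimate and the lower bound for `‖K_a‖` give `|f(a)|² / ‖K_a‖² ≤ (W / c) ∫ |f|² dμ`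
  -- over the cell, which vanishes by absolute continuity of the integral.
  have h3 : Tendsto (fun a => W / c *
      (∫⁻ z in cell a 1, ‖holo f z‖ₑ ^ 2 ∂(weightMeasure u)).toReal) toCircle (𝓝 0) := by
    simpa using h2.const_mul (W / c)
  have h4 : Tendsto (fun a => (‖holo f a‖ / ‖kernel u a‖) ^ 2) toCircle (𝓝 0) := by
    refine squeeze_zero' (Eventually.of_forall fun a => by positivity) ?_ h3
    filter_upwards [eventually_mem_disc] with a ha
    have hm := cell_measure_pos hu ha one_pos le_rfl
    have h5 := enorm_sq_mul_cell_le hu hW (holo_differentiableOn f) ha one_pos le_rfl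
    have hfin' : ∫⁻ z in cell a 1, ‖holo f z‖ₑ ^ 2 ∂(weightMeasure u) ≠ ∞ :=
      ((setLIntegral_le_lintegral _ _).trans_lt hfin.lt_top).ne
    have h6 := ENNReal.toReal_mono (by finiteness) h5
    simp only [ENNReal.toReal_mul, ENNReal.toReal_pow, toReal_enorm, one_pow, div_one,
      ENNReal.toReal_ofReal hW0.le] at h6
    have h7 := hc a ha
    have hk : 0 < ‖kernel u a‖ ^ 2 := pos_of_mul_pos_left (hc0.trans_le h7) hm.le
    have h6' : ‖holo f a‖ ^ 2 * (weightMeasure u).real (cell a 1) ≤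
      W * (∫⁻ z in cell a 1, ‖holo f z‖ₑ ^ 2 ∂(weightMeasure u)).toReal := h6
    generalize (∫⁻ z in cell a 1, ‖holo f z‖ₑ ^ 2 ∂(weightMeasure u)).toReal = I at *
    rw [div_pow, div_le_iff₀ hk, div_mul_eq_mul_div, div_mul_eq_mul_div, le_div_iff₀ hc0]
    calc ‖holo f a‖ ^ 2 * c
        ≤ ‖holo f a‖ ^ 2 * (‖kernel u a‖ ^ 2 * (weightMeasure u).real (cell a 1)) := by gcongr
      _ = ‖holo f a‖ ^ 2 * (weightMeasure u).real (cell a 1) * ‖kernel u a‖ ^ 2 := by ring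
      _ ≤ W * I * ‖kernel u a‖ ^ 2 := by gcongr
  have h5 := (Real.continuous_sqrt.tendsto 0).comp h4
  rw [Real.sqrt_zero] at h5
  refine h5.congr fun a => ?_
  exact Real.sqrt_sq (by positivity)

/-- By Hermitian symmetry the integral formula at `a` gives `(T K_a)(a) = ∫ |K_a|² dν`, and
evaluation at `a` has norm `‖K_a‖`. -/
theorem lintegral_kernel_sq (hu : IsB2Weight u) (hν : ν discᶜ = 0)
    {T : bergmanSpace u →L[ℂ] bergmanSpace u} (hT : IsToeplitzOn u ν (kernels u) T) {a : ℂ}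
    (ha : a ∈ disc) :
    ∫⁻ w, ‖holo (kernel u a) w‖ₑ ^ 2 ∂ν ≤ ENNReal.ofReal (‖kernel u a‖ * ‖T (kernel u a)‖) := by
  obtain ⟨hint, heq⟩ := hT (kernel u a) ⟨a, ha, rfl⟩ a ha
  have hd : ∀ᵐ w ∂ν, w ∈ disc := hν
  have hae : (fun w => K u a w * holo (kernel u a) w) =ᵐ[ν]
      fun w => ((‖holo (kernel u a) w‖ ^ 2 : ℝ) : ℂ) := by
    filter_upwards [hd] with w hw
    rw [K, holo_kernel_symm hu ha hw, Complex.conj_mul']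
    push_cast; rfl
  rw [integral_congr_ae hae, integral_complex_ofReal] at heq
  have hint' : Integrable (fun w => ‖holo (kernel u a) w‖ ^ 2) ν := by
    refine (hint.congr hae).norm.congr (Eventually.of_forall fun w => ?_)
    simp only [Complex.norm_real, norm_pow, norm_norm]
  have h1 := ofReal_integral_eq_lintegral_ofReal hint'
    (Eventually.of_forall fun w => by positivity)
  have h2 : ∫⁻ w, ‖holo (kernel u a) w‖ₑ ^ 2 ∂ν =
      ∫⁻ w, ENNReal.ofReal (‖holo (kernel u a) w‖ ^ 2) ∂ν := by
    refine lintegral_congr fun w => ?_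
    rw [ENNReal.ofReal_pow (norm_nonneg _), ofReal_norm]
  rw [h2, ← h1]
  refine ENNReal.ofReal_le_ofReal ?_
  have h3 := norm_holo_le_kernel hu ha (T (kernel u a))
  rw [heq, Complex.norm_real] at h3
  exact (le_abs_self _).trans h3

/-- Since `|K_a| ≥ ‖K_a‖² / 2` on the small cell, its `ν`-mass is at most `4 ‖T k_a‖ / ‖K_a‖²` for
the normalized kernel `k_a`. Here `1 / ‖K_a‖²` is at most a multiple of `μ(cell a 1)`, and `‖T k_a‖
→ 0` because `T` is compact. -/
theorem ToeplitzCompact.vanishingOnCells (hu : IsB2Weight u) (hν : ν discᶜ = 0)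
    (h : ToeplitzCompact u ν (kernels u)) : VanishingOnCells u ν := by
  have := completeSpace_bergmanSpace hu
  have := isFiniteMeasure_weightMeasure hu
  obtain ⟨T, hT, hTc⟩ := h
  obtain ⟨ε, hε0, hε1, hε⟩ := exists_kernel_near_diagonal hu
  obtain ⟨c, hc0, hc⟩ := exists_le_norm_kernel hu
  have hkpos : ∀ a ∈ disc, 0 < ‖kernel u a‖ := fun a ha => by
    have := pos_of_mul_pos_left (hc0.trans_le (hc a ha)) measureReal_nonneg
    exact lt_of_le_of_ne (norm_nonneg _) fun h => by simp [← h] at this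
  have key : ∀ a ∈ disc,
      ν (cell a ε) ≤ ENNReal.ofReal (4 * ‖T (kernel u a)‖ / ‖kernel u a‖ ^ 3) := by
    intro a ha
    have hk := hkpos a ha
    have h1 : ENNReal.ofReal ((‖kernel u a‖ ^ 2 / 2) ^ 2) * ν (cell a ε) ≤
        ENNReal.ofReal (‖kernel u a‖ * ‖T (kernel u a)‖) := by
      refine le_trans ?_ (lintegral_kernel_sq hu hν hT ha)
      rw [← setLIntegral_const]
      refine le_trans (setLIntegral_mono' (measurableSet_cell a ε) fun w hw => ?_)
        (setLIntegral_le_lintegral (cell a ε) _)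
      rw [← ofReal_norm, ← ENNReal.ofReal_pow (norm_nonneg _)]
      refine ENNReal.ofReal_le_ofReal ?_
      have := hε a ha w hw
      gcongr
    have hne : ENNReal.ofReal ((‖kernel u a‖ ^ 2 / 2) ^ 2) ≠ 0 := by
      rw [Ne, ENNReal.ofReal_eq_zero, not_le]; positivity
    refine (ENNReal.mul_le_mul_iff_right hne ENNReal.ofReal_ne_top).1 (h1.trans (le_of_eq ?_))
    rw [← ENNReal.ofReal_mul (by positivity)]
    congr 1
    field_simp
    ring
  refine ⟨ε, hε0, hε1, fun a ha => (key a ha).trans_lt ENNReal.ofReal_lt_top, fun δ hδ => ?_⟩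
  set x : ℂ → bergmanSpace u := fun a => ((‖kernel u a‖⁻¹ : ℝ) : ℂ) • kernel u a with hx
  have hx1 : ∀ᶠ a in toCircle, ‖x a‖ ≤ 1 := by
    refine Eventually.of_forall fun a => ?_
    rw [hx, norm_smul, Complex.norm_real, norm_inv, norm_norm]
    exact inv_mul_le_one
  have hxw : ∀ y : bergmanSpace u,
      Tendsto (fun a => @inner ℂ (bergmanSpace u) InnerProductSpace.toInner y (x a))
        toCircle (𝓝 0) := by
    intro y
    rw [tendsto_zero_iff_norm_tendsto_zero]
    refine (tendsto_inner_kernel hu y).congr' ?_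
    filter_upwards [eventually_mem_disc] with a ha
    have e : @inner ℂ (bergmanSpace u) InnerProductSpace.toInner y (x a) =
        ((‖kernel u a‖⁻¹ : ℝ) : ℂ) *
          @inner ℂ (bergmanSpace u) InnerProductSpace.toInner y (kernel u a) :=
      inner_smul_right (𝕜 := ℂ) y (kernel u a) _
    rw [e, norm_mul, Complex.norm_real, norm_inv, norm_norm, norm_inner_symm,
      inner_kernel hu ha, div_eq_inv_mul]
  have ht := tendsto_norm_of_isCompactOperator hTc hx1 hxw
  have hev := ht.eventually (gt_mem_nhds (show 0 < δ * c / 4 by positivity))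
  filter_upwards [hev, eventually_mem_disc] with a h1 ha
  have hk := hkpos a ha
  have hm := cell_measure_pos hu ha one_pos le_rfl
  rw [hx, map_smul, norm_smul, Complex.norm_real, norm_inv, norm_norm, inv_mul_lt_iff₀ hk] at h1
  refine (key a ha).trans ?_
  rw [← ENNReal.ofReal_toReal (show weightMeasure u (cell a 1) ≠ ∞ by finiteness),
    ← ENNReal.ofReal_mul hδ.le]
  refine ENNReal.ofReal_le_ofReal ?_
  rw [div_le_iff₀ (by positivity)]
  have h2 := hc a ha
  have h3 : δ * ‖kernel u a‖ * c ≤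
      δ * ‖kernel u a‖ * (‖kernel u a‖ ^ 2 * (weightMeasure u).real (cell a 1)) := by gcongr
  rw [Measure.real] at h3
  nlinarith

/-! ### From cells to tails -/

theorem measure_closedBall_lt_top_of_cells {ε : ℝ} (hε : 0 < ε)
    (h : ∀ a ∈ disc, ν (cell a ε) < ∞) {r : ℝ} (hr : r < 1) : ν (closedBall 0 r) < ∞ := by
  refine (isCompact_closedBall (0 : ℂ) r).measure_lt_top_of_nhdsWithin fun a ha => ?_
  rw [mem_closedBall, dist_zero_right] at ha
  have had : a ∈ disc := by simpa using ha.trans_lt hr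
  refine ⟨cell a ε, mem_nhdsWithin_of_mem_nhds (ball_mem_nhds _ ?_), h a had⟩
  exact mul_pos hε (by linarith)

/-- Supplies the σ-finiteness that the Tonelli argument needs. -/
theorem sigmaFinite_of_closedBall (hν : ν discᶜ = 0)
    (h : ∀ r : ℝ, r < 1 → ν (closedBall 0 r) < ∞) : SigmaFinite ν := by
  refine ⟨⟨⟨fun n : ℕ => closedBall 0 (1 - 1 / ((n : ℝ) + 1)) ∪ discᶜ, fun _ => trivial,
    fun n => ?_, ?_⟩⟩⟩
  · refine (measure_union_le _ _).trans_lt ?_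
    rw [hν, add_zero]
    exact h _ (by simp; positivity)
  · refine Set.eq_univ_of_forall fun z => Set.mem_iUnion.2 ?_
    by_cases hz : z ∈ disc
    · have hz1 : ‖z‖ < 1 := by simpa using hz
      obtain ⟨n, hn⟩ := exists_nat_one_div_lt (show 0 < 1 - ‖z‖ by linarith)
      refine ⟨n, Or.inl ?_⟩
      rw [mem_closedBall, dist_zero_right]
      linarith
    · exact ⟨0, Or.inr hz⟩

theorem measurable_weightMeasure_cell (hu : IsB2Weight u) :
    Measurable fun w => weightMeasure u (cell w 1) := by
  have := isFiniteMeasure_weightMeasure hu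
  have h : MeasurableSet {p : ℂ × ℂ | dist p.2 p.1 < 1 * (1 - ‖p.1‖)} :=
    (isOpen_lt (by fun_prop) (by fun_prop)).measurableSet
  exact measurable_measure_prodMk_left h

/-- Exchanges centre and point in Tonelli's theorem, at the cost of doubling the radius, and keeps
`w` near the circle when `z` is. -/
theorem mem_cell_symm {z w : ℂ} {ε : ℝ} (h1 : ε ≤ 1 / 2) (hz : z ∈ disc)
    (hw : w ∈ cell z (ε / 2)) : z ∈ cell w ε ∧ 1 - ‖w‖ ≤ 2 * (1 - ‖z‖) := by
  have hz1 : ‖z‖ < 1 := by simpa using hz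
  have hd : 0 < 1 - ‖z‖ := by linarith
  rw [cell, mem_ball, dist_eq_norm] at hw
  have hε : 0 < ε := by
    have := (norm_nonneg _).trans_lt hw
    nlinarith [pos_of_mul_pos_left this hd.le]
  have h2 := norm_sub_norm_le w z
  have h3 := norm_sub_norm_le z w
  rw [norm_sub_rev] at h3
  refine ⟨?_, by nlinarith⟩
  rw [cell, mem_ball, dist_comm, dist_eq_norm]
  nlinarith

/-- Comparability of cells moves the normalizing weight inside the integral, centred at `w` rather
than `z`, so that after Tonelli it cancels against the bound on `ν(cell w ε)`. -/
theorem enorm_sq_le_averaged (hu : IsB2Weight u) {W : ℝ} (hW0 : 0 < W) (hW : IsWindowConst u W)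
    {F : ℂ → ℂ} (hF : DifferentiableOn ℂ F disc) {z : ℂ} (hz : z ∈ disc) {ε : ℝ} (h0 : 0 < ε)
    (h1 : ε ≤ 1 / 2) :
    ‖F z‖ₑ ^ 2 ≤ ENNReal.ofReal (W / ε ^ 4 * (4096 * W)) *
      ∫⁻ w in cell z ε, ‖F w‖ₑ ^ 2 / weightMeasure u (cell w 1) ∂(weightMeasure u) := by
  have := isFiniteMeasure_weightMeasure hu
  have hz1 : ‖z‖ < 1 := by simpa using hz
  have h := enorm_sq_mul_cell_le hu hW hF hz h0 (by linarith)
  set m := weightMeasure u (cell z 1) with hm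
  have hmpos : 0 < m := (ENNReal.toReal_pos_iff.1 (cell_measure_pos hu hz one_pos le_rfl)).1
  have hmtop : m ≠ ∞ := by finiteness
  have h2 : ∫⁻ w in cell z ε, ‖F w‖ₑ ^ 2 ∂(weightMeasure u) ≤ ENNReal.ofReal (4096 * W) * m *
      ∫⁻ w in cell z ε, ‖F w‖ₑ ^ 2 / weightMeasure u (cell w 1) ∂(weightMeasure u) := by
    rw [← lintegral_const_mul' _ _ (by finiteness)]
    refine setLIntegral_mono' (measurableSet_cell z ε) fun w hw => ?_
    have hw' : w ∈ cell z (1 / 2) := ball_subset_ball (by nlinarith) hw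
    have hwd := cell_subset_disc hz (by norm_num) hw'
    have h3 := (cell_comparable hu hW hz hw').2
    have h4 : weightMeasure u (cell w 1) ≤ ENNReal.ofReal (4096 * W) * m := by
      rw [← ENNReal.ofReal_toReal hmtop, ← ENNReal.ofReal_mul (by positivity),
        ← ENNReal.ofReal_toReal (show weightMeasure u (cell w 1) ≠ ∞ by finiteness)]
      exact ENNReal.ofReal_le_ofReal h3
    have h5 : weightMeasure u (cell w 1) ≠ 0 :=
      (ENNReal.toReal_pos_iff.1 (cell_measure_pos hu hwd one_pos le_rfl)).1.ne'
    calc ‖F w‖ₑ ^ 2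
        = weightMeasure u (cell w 1) * (‖F w‖ₑ ^ 2 / weightMeasure u (cell w 1)) :=
          (ENNReal.mul_div_cancel h5 (by finiteness)).symm
      _ ≤ _ := by gcongr
  have h6 := h.trans (mul_le_mul_right h2 _)
  refine (ENNReal.mul_le_mul_iff_right hmpos.ne' hmtop).1 ?_
  rw [mul_comm]
  refine h6.trans (le_of_eq ?_)
  rw [ENNReal.ofReal_mul (show 0 ≤ W / ε ^ 4 by positivity)]
  ring

/-- Dominate `|F(z)|²` by its cell average and exchange integrals: each `w` then carries `|F(w)|²
ν(cell w ε) / μ(cell w 1)`, which is small for `w` near the circle, and only such `w` contribute. -/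
theorem VanishingOnCells.vanishingTails (hu : IsB2Weight u) (hν : ν discᶜ = 0)
    (h : VanishingOnCells u ν) : VanishingTails u ν := by
  have := isFiniteMeasure_weightMeasure hu
  obtain ⟨ε, hε0, hε1, hfin, hvan⟩ := h
  obtain ⟨W, hW0, hW⟩ := exists_window_bound hu
  have hball : ∀ r : ℝ, r < 1 → ν (closedBall 0 r) < ∞ := fun r hr =>
    measure_closedBall_lt_top_of_cells hε0 hfin hr
  have := sigmaFinite_of_closedBall hν hball
  refine ⟨hball, fun δ hδ => ?_⟩
  set c := W / (ε / 2) ^ 4 * (4096 * W) with hc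
  have hc0 : 0 < c := by positivity
  obtain ⟨r₀, hr₀, hr₀'⟩ := eventually_toCircle.1 (hvan (δ / c) (by positivity))
  -- Here `1 - r = (1 - r₀) / 4`, so `‖z‖ > r` and `1 - ‖w‖ ≤ 2 (1 - ‖z‖)` give `‖w‖ > r₀`.
  refine ⟨(3 + r₀) / 4, by linarith, fun F hF => ?_⟩
  set r := (3 + r₀) / 4 with hr
  set A : Set ℂ := (closedBall 0 r)ᶜ with hA
  have hAm : MeasurableSet A := measurableSet_closedBall.compl
  set μ := weightMeasure u
  -- `F` is arbitrary off the disc; the indicator makes `G` measurable on the whole plane.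
  set G : ℂ → ℝ≥0∞ := fun w => (disc.indicator (fun z => ‖F z‖ₑ) w) ^ 2 / μ (cell w 1) with hG
  have hGm : Measurable G :=
    ((measurable_indicator_enorm measurableSet_disc hF.continuousOn).pow_const 2).div
      (measurable_weightMeasure_cell hu)
  set S : Set (ℂ × ℂ) := {p | dist p.2 p.1 < ε / 2 * (1 - ‖p.1‖)} with hS
  have hSm : MeasurableSet S := (isOpen_lt (by fun_prop) (by fun_prop)).measurableSet
  have hνd : ∀ᵐ z ∂(ν.restrict A), z ∈ disc := ae_restrict_of_ae hν
  have step1 : ∫⁻ z in A, ‖F z‖ₑ ^ 2 ∂ν ≤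
      ∫⁻ z in A, ENNReal.ofReal c * ∫⁻ w, S.indicator (fun p => G p.2) (z, w) ∂μ ∂ν := by
    refine lintegral_mono_ae ?_
    filter_upwards [hνd] with z hz
    refine (enorm_sq_le_averaged hu hW0 hW hF hz (half_pos hε0) (by linarith)).trans ?_
    rw [← lintegral_indicator (measurableSet_cell z (ε / 2))]
    gcongr with w
    by_cases hw : w ∈ cell z (ε / 2)
    · have hwd := cell_subset_disc hz (by linarith) hw
      have hwS : (z, w) ∈ S := hw
      rw [Set.indicator_of_mem hw, Set.indicator_of_mem hwS, hG]
      simp only [Set.indicator_of_mem hwd]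
      exact le_rfl
    · rw [Set.indicator_of_notMem hw]
      exact zero_le
  have hswap : ∫⁻ z in A, ∫⁻ w, S.indicator (fun p => G p.2) (z, w) ∂μ ∂ν =
      ∫⁻ w, ∫⁻ z in A, S.indicator (fun p => G p.2) (z, w) ∂ν ∂μ := by
    refine lintegral_lintegral_swap ?_
    exact ((hGm.comp measurable_snd).indicator hSm).aemeasurable
  have step2 : ∀ w ∈ disc, ∫⁻ z in A, S.indicator (fun p => G p.2) (z, w) ∂ν ≤
      ENNReal.ofReal (δ / c) * ‖F w‖ₑ ^ 2 := by
    intro w hw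
    have hw1 : ‖w‖ < 1 := by simpa using hw
    have hpt : ∀ᵐ z ∂(ν.restrict A), S.indicator (fun p => G p.2) (z, w) ≤
        (cell w ε).indicator (fun _ => if r₀ < ‖w‖ then G w else 0) z := by
      filter_upwards [hνd, ae_restrict_mem hAm] with z hz hzA
      by_cases hzw : (z, w) ∈ S
      · have hwz : w ∈ cell z (ε / 2) := hzw
        obtain ⟨h1, h2⟩ := mem_cell_symm hε1 hz hwz
        have h3 : r < ‖z‖ := by simpa [hA] using hzA
        rw [Set.indicator_of_mem hzw, Set.indicator_of_mem h1, if_pos (by linarith)]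
      · rw [Set.indicator_of_notMem hzw]
        exact zero_le
    refine (lintegral_mono_ae hpt).trans ((setLIntegral_le_lintegral _ _).trans ?_)
    rw [lintegral_indicator (measurableSet_cell w ε), setLIntegral_const]
    split_ifs with h
    · have h5 : μ (cell w 1) ≠ 0 :=
        (ENNReal.toReal_pos_iff.1 (cell_measure_pos hu hw one_pos le_rfl)).1.ne'
      refine (mul_le_mul_right (hr₀' w hw h) _).trans (le_of_eq ?_)
      rw [hG]
      simp only [Set.indicator_of_mem hw]
      rw [mul_left_comm, ENNReal.div_mul_cancel h5 (by finiteness)]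
    · rw [zero_mul]
      exact zero_le
  calc ∫⁻ z in A, ‖F z‖ₑ ^ 2 ∂ν
      ≤ ENNReal.ofReal c * ∫⁻ w, ∫⁻ z in A, S.indicator (fun p => G p.2) (z, w) ∂ν ∂μ := by
        rw [← hswap, ← lintegral_const_mul' _ _ ENNReal.ofReal_ne_top]
        exact step1
    _ ≤ ENNReal.ofReal c * ∫⁻ w, ENNReal.ofReal (δ / c) * ‖F w‖ₑ ^ 2 ∂μ := by
        refine mul_le_mul_right (lintegral_mono_ae ?_) _
        filter_upwards [ae_mem_disc u] with w hw using step2 w hw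
    _ = _ := by
        rw [lintegral_const_mul' _ _ ENNReal.ofReal_ne_top, ← mul_assoc,
          ← ENNReal.ofReal_mul hc0.le, mul_div_cancel₀ _ hc0.ne']

/-! ### Tails and the Berezin transform -/

theorem norm_one_sub_le {a z : ℂ} (ha : a ∈ disc) {ε : ℝ} (h1 : ε ≤ 1) (hz : z ∈ cell a ε) :
    ‖1 - (starRingEnd ℂ) a * z‖ ≤ 3 * (1 - ‖a‖) := by
  have ha1 : ‖a‖ < 1 := by simpa using ha
  rw [cell, mem_ball, dist_comm, dist_eq_norm] at hz
  have e : 1 - (starRingEnd ℂ) a * z =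
      ((1 - ‖a‖ ^ 2 : ℝ) : ℂ) + (starRingEnd ℂ) a * (a - z) := by
    rw [mul_sub, Complex.conj_mul']; push_cast; ring
  rw [e]
  refine (norm_add_le _ _).trans ?_
  rw [Complex.norm_real, norm_mul, RCLike.norm_conj, Real.norm_of_nonneg
    (by nlinarith [norm_nonneg a])]
  nlinarith [norm_nonneg a, norm_nonneg (a - z)]

theorem measure_cell_le_lintegral_B (κ : Measure ℂ) {a : ℂ} (ha : a ∈ disc) {ε : ℝ} (h1 : ε ≤ 1) :
    ENNReal.ofReal (((3 * (1 - ‖a‖)) ^ 4)⁻¹) * κ (cell a ε) ≤ ∫⁻ z, ‖B a z‖ₑ ^ 2 ∂κ := by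
  rw [← setLIntegral_const]
  refine le_trans (setLIntegral_mono' (measurableSet_cell a ε) fun z hz => ?_)
    (setLIntegral_le_lintegral _ _)
  exact le_enorm_B_sq (norm_pos_iff.2 (one_sub_ne_zero ha (cell_subset_disc ha h1 hz)))
    (norm_one_sub_le ha h1 hz)

/-- The lower bound for the norm of `B a` in `A²(u)`. -/
theorem one_le_mul_lintegral_B (hu : IsB2Weight u) {a : ℂ} (ha : a ∈ disc) :
    1 ≤ 81 * (∫⁻ z, ‖B a z‖ₑ ^ 2 ∂(weightMeasure u)) *
      weightMeasure (fun z => (u z)⁻¹) (cell a 1) := by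
  have := isFiniteMeasure_weightMeasure hu
  have := isFiniteMeasure_weightMeasure hu.inv
  have ha1 : ‖a‖ < 1 := by simpa using ha
  have hd : 0 < 1 - ‖a‖ := by linarith
  have h1 := measure_cell_le_lintegral_B (weightMeasure u) ha le_rfl
  have h2 := area_sq_le hu (measurableSet_cell a 1)
  rw [area_cell ha zero_le_one le_rfl] at h2
  have h3 : (1 : ℝ≥0∞) ≤ 81 * (ENNReal.ofReal (((3 * (1 - ‖a‖)) ^ 4)⁻¹) *
      weightMeasure u (cell a 1)) * weightMeasure (fun z => (u z)⁻¹) (cell a 1) := by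
    rw [← ENNReal.ofReal_toReal (show weightMeasure u (cell a 1) ≠ ∞ by finiteness),
      ← ENNReal.ofReal_toReal
        (show weightMeasure (fun z => (u z)⁻¹) (cell a 1) ≠ ∞ by finiteness),
      ← ENNReal.ofReal_mul (by positivity), show (81 : ℝ≥0∞) = ENNReal.ofReal 81 by simp,
      ← ENNReal.ofReal_mul (by positivity), ← ENNReal.ofReal_mul (by positivity),
      ENNReal.one_le_ofReal]
    simp only [Measure.real] at h2
    rw [mul_pow, mul_inv]
    have e : ∀ x y d : ℝ, 81 * ((3 ^ 4)⁻¹ * (d ^ 4)⁻¹ * x) * y = (x * y) / d ^ 4 := by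
      intro x y d; rw [div_eq_mul_inv]; ring
    rw [e, one_le_div (by positivity)]
    calc _ = (1 ^ 2 * (1 - ‖a‖) ^ 2) ^ 2 := by ring
      _ ≤ _ := h2
  refine h3.trans ?_
  gcongr

theorem lintegral_B_ne_zero (hu : IsB2Weight u) {a : ℂ} (ha : a ∈ disc) :
    ∫⁻ z, ‖B a z‖ₑ ^ 2 ∂(weightMeasure u) ≠ 0 := by
  intro h
  have := one_le_mul_lintegral_B hu ha
  simp [h] at this

theorem lintegral_B_ne_top (hu : IsB2Weight u) {a : ℂ} (ha : a ∈ disc) :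
    ∫⁻ z, ‖B a z‖ₑ ^ 2 ∂(weightMeasure u) ≠ ∞ := by
  obtain ⟨C, -, hC⟩ := exists_lintegral_B_le hu
  exact ((hC a ha).trans_lt ENNReal.ofReal_lt_top).ne

/-- On a fixed smaller disc `|B_a|²` stays bounded, whereas `‖B_a‖² ≥ 1 / (81 σ(cell a 1))` tends to
infinity; outside it the tail condition applies to `F = B_a`. -/
theorem VanishingTails.tendsto_berezin (hu : IsB2Weight u) (h : VanishingTails u ν) :
    Tendsto (berezin u ν) toCircle (𝓝 0) := by
  obtain ⟨hfin, htail⟩ := h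
  rw [ENNReal.tendsto_nhds_zero]
  intro ε hε
  obtain ⟨δ, hδ0, hδ⟩ : ∃ δ : ℝ, 0 < δ ∧ ENNReal.ofReal δ ≤ ε / 2 := by
    obtain ⟨q, hq0, hq⟩ := ENNReal.lt_iff_exists_nnreal_btwn.1 (ENNReal.half_pos hε.ne')
    exact ⟨q, by exact_mod_cast hq0, by rw [ENNReal.ofReal_coe_nnreal]; exact hq.le⟩
  obtain ⟨r, hr1, hr⟩ := htail δ hδ0
  set N := ENNReal.ofReal (((1 - r) ^ 4)⁻¹) * ν (closedBall 0 r) with hN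
  have hNtop : N ≠ ∞ := ENNReal.mul_ne_top ENNReal.ofReal_ne_top (hfin r hr1).ne
  have ht : Tendsto (fun a => N * 81 * weightMeasure (fun z => (u z)⁻¹) (cell a 1)) toCircle
      (𝓝 0) := by
    have := ENNReal.Tendsto.const_mul (a := N * 81) (tendsto_weightMeasure_cell hu.inv)
      (Or.inr (ENNReal.mul_ne_top hNtop (by simp)))
    simpa using this
  filter_upwards [eventually_mem_disc, ENNReal.tendsto_nhds_zero.1 ht (ε / 2)
    (ENNReal.half_pos hε.ne')] with a ha h2
  have ha1 : ‖a‖ < 1 := by simpa using ha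
  set Y := ∫⁻ z, ‖B a z‖ₑ ^ 2 ∂(weightMeasure u) with hY
  have hY0 : Y ≠ 0 := lintegral_B_ne_zero hu ha
  have hYtop : Y ≠ ∞ := lintegral_B_ne_top hu ha
  have hX : ∫⁻ z, ‖B a z‖ₑ ^ 2 ∂ν ≤ N + ENNReal.ofReal δ * Y := by
    rw [← lintegral_add_compl _ (measurableSet_closedBall (x := (0 : ℂ)) (ε := r))]
    refine add_le_add ?_ (hr _ (differentiableOn_B ha))
    rw [hN, ← setLIntegral_const]
    refine setLIntegral_mono' measurableSet_closedBall fun z hz => ?_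
    rw [mem_closedBall, dist_zero_right] at hz
    exact enorm_B_sq_le (by linarith)
      (one_sub_le_norm_one_sub (by nlinarith [norm_nonneg z, norm_nonneg a]))
  rw [berezin, ENNReal.div_le_iff_le_mul (Or.inl hY0) (Or.inl hYtop)]
  refine hX.trans ?_
  rw [← ENNReal.add_halves ε, add_mul]
  refine add_le_add ?_ (by gcongr)
  calc N = N * 1 := (mul_one N).symm
    _ ≤ N * (81 * Y * weightMeasure (fun z => (u z)⁻¹) (cell a 1)) := by
        gcongr; exact one_le_mul_lintegral_B hu ha
    _ = N * 81 * weightMeasure (fun z => (u z)⁻¹) (cell a 1) * Y := by ring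
    _ ≤ ε / 2 * Y := by gcongr

theorem measure_lt_top_of_lintegral_B (hν : ν discᶜ = 0) {a : ℂ} (ha : a ∈ disc)
    (h : ∫⁻ z, ‖B a z‖ₑ ^ 2 ∂ν < ∞) : ν Set.univ < ∞ := by
  have ha1 : ‖a‖ < 1 := by simpa using ha
  have h1 : ENNReal.ofReal (((2 : ℝ) ^ 4)⁻¹) * ν Set.univ ≤ ∫⁻ z, ‖B a z‖ₑ ^ 2 ∂ν := by
    rw [← lintegral_const]
    have hd : ∀ᵐ z ∂ν, z ∈ disc := hν
    refine lintegral_mono_ae ?_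
    filter_upwards [hd] with z hz
    refine le_enorm_B_sq (norm_pos_iff.2 (one_sub_ne_zero ha hz)) ?_
    have hz1 : ‖z‖ < 1 := by simpa using hz
    refine (norm_sub_le _ _).trans ?_
    rw [norm_one, norm_mul, RCLike.norm_conj]
    nlinarith [norm_nonneg z, norm_nonneg a]
  have h2 := h1.trans_lt h
  rw [ENNReal.mul_lt_top_iff] at h2
  rcases h2 with h2 | h2 | h2
  · exact h2.2
  · norm_num at h2
  · simp [h2]

/-- On the cell `|B_a|² ≥ (3 d)⁻⁴`, while `‖B_a‖² ≤ C μ(cell a 1) / d⁴`; powers of `d` cancel and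
`81 C` remains. -/
theorem vanishingOnCells_of_tendsto_berezin (hu : IsB2Weight u) (hν : ν discᶜ = 0)
    (h : Tendsto (berezin u ν) toCircle (𝓝 0)) : VanishingOnCells u ν := by
  have := isFiniteMeasure_weightMeasure hu
  obtain ⟨C, hC0, hC⟩ := exists_lintegral_B_le hu
  have hle : ∀ δ : ℝ≥0∞, 0 < δ → ∀ᶠ a in toCircle, ∫⁻ z, ‖B a z‖ₑ ^ 2 ∂ν ≤
      δ * ∫⁻ z, ‖B a z‖ₑ ^ 2 ∂(weightMeasure u) := by
    intro δ hδ
    filter_upwards [ENNReal.tendsto_nhds_zero.1 h δ hδ, eventually_mem_disc] with a h1 ha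
    rwa [berezin, ENNReal.div_le_iff_le_mul (Or.inl (lintegral_B_ne_zero hu ha))
      (Or.inl (lintegral_B_ne_top hu ha))] at h1
  -- The limit says nothing about cells far from the circle, but a single `a` with `∫ |B_a|² dν`
  -- finite makes `ν` finite. The maximum with 0 covers a negative `r`.
  have hfin : ν Set.univ < ∞ := by
    obtain ⟨r, hr1, hr⟩ := eventually_toCircle.1 (hle 1 one_pos)
    set t := max ((1 + r) / 2) 0 with ht
    have ht0 : 0 ≤ t := le_max_right _ _
    have ht1 : t < 1 := max_lt (by linarith) one_pos
    have hrt : r < t := (by linarith : r < (1 + r) / 2).trans_le (le_max_left _ _)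
    have hn : ‖(t : ℂ)‖ = t := by rw [Complex.norm_real, Real.norm_of_nonneg ht0]
    have htd : (t : ℂ) ∈ disc := mem_ball_zero_iff.2 (by rwa [hn])
    have := hr t htd (by rwa [hn])
    rw [one_mul] at this
    exact measure_lt_top_of_lintegral_B hν htd (this.trans_lt (lintegral_B_ne_top hu htd).lt_top)
  refine ⟨1 / 2, by norm_num, le_rfl, fun a _ => (measure_mono (Set.subset_univ _)).trans_lt hfin,
    fun δ hδ => ?_⟩
  filter_upwards [hle (ENNReal.ofReal (δ / (81 * C))) (by rw [ENNReal.ofReal_pos]; positivity),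
    eventually_mem_disc] with a h1 ha
  have ha1 : ‖a‖ < 1 := by simpa using ha
  have hd : 0 < 1 - ‖a‖ := by linarith
  have hm := (cell_measure_pos hu ha one_pos le_rfl).le
  have h2 := (measure_cell_le_lintegral_B ν ha (ε := 1 / 2) (by norm_num)).trans
    (h1.trans (mul_le_mul_right (hC a ha) _))
  have hne : ENNReal.ofReal (((3 * (1 - ‖a‖)) ^ 4)⁻¹) ≠ 0 := by
    rw [Ne, ENNReal.ofReal_eq_zero, not_le]; positivity
  refine (ENNReal.mul_le_mul_iff_right hne ENNReal.ofReal_ne_top).1 (h2.trans (le_of_eq ?_))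
  rw [← ENNReal.ofReal_toReal (show weightMeasure u (cell a 1) ≠ ∞ by finiteness),
    ← ENNReal.ofReal_mul (by positivity), ← ENNReal.ofReal_mul (by positivity),
    ← ENNReal.ofReal_mul (by positivity)]
  congr 1
  rw [Measure.real]
  field_simp
  ring

/-! ### Tails and compactness of the inclusion -/

/-- The unit ball of `A²(u)` is uniformly equicontinuous on compact subsets of the disc. -/
theorem exists_norm_holo_sub_le (hu : IsB2Weight u) {r : ℝ} (hr : r < 1) {η : ℝ} (hη : 0 < η) :
    ∃ ρ > 0, ∀ f : bergmanSpace u, ∀ z ∈ closedBall (0 : ℂ) r, ∀ w, dist w z < ρ →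
      ‖holo f w - holo f z‖ ≤ η * ‖f‖ := by
  obtain ⟨M, hM0, hM⟩ := exists_norm_holo_le hu (r := (1 + r) / 2) (by linarith)
  set R := (1 - r) / 2 with hR
  have hR0 : 0 < R := by rw [hR]; linarith
  refine ⟨min R (η * R / (2 * M)), by positivity, fun f z hz w hw => ?_⟩
  rw [mem_closedBall, dist_zero_right] at hz
  have hsub : ball z R ⊆ closedBall 0 ((1 + r) / 2) := by
    refine ball_subset_closedBall.trans (closedBall_subset_closedBall' ?_)
    rw [dist_zero_right, hR]; linarith
  have hdisc : ball z R ⊆ disc :=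
    hsub.trans (closedBall_subset_ball (by linarith))
  have hmaps : Set.MapsTo (holo f) (ball z R) (closedBall (holo f z) (2 * (M * ‖f‖))) := by
    intro x hx
    rw [mem_closedBall, dist_eq_norm]
    refine (norm_sub_le _ _).trans ?_
    linarith [hM f x (hsub hx), hM f z (hsub (mem_ball_self hR0))]
  have hw1 : w ∈ ball z R := hw.trans_le (min_le_left _ _)
  have h := Complex.dist_le_div_mul_dist_of_mapsTo_ball ((holo_differentiableOn f).mono hdisc)
    hmaps hw1
  rw [dist_eq_norm] at h
  have hw2 : dist w z ≤ η * R / (2 * M) := hw.le.trans (min_le_right _ _)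
  refine h.trans ?_
  calc _ ≤ 2 * (M * ‖f‖) / R * (η * R / (2 * M)) := by gcongr
    _ = _ := by field_simp

/-- On a smaller closed disc, of finite `ν`-mass `N`, functions are bounded by `M ‖f‖`; the tail
condition with `δ = 1` handles the rest, whence `M² N + 1`. -/
theorem exists_inclusion (hu : IsB2Weight u) (hν : ν discᶜ = 0) (h : VanishingTails u ν) :
    ∃ i : bergmanSpace u →L[ℂ] Lp ℂ 2 ν, (∀ f, i f =ᵐ[ν] holo f) := by
  obtain ⟨hfin, htail⟩ := h
  obtain ⟨r, hr1, hr⟩ := htail 1 one_pos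
  obtain ⟨M, hM0, hM⟩ := exists_norm_holo_le hu hr1
  have hN := (hfin r hr1).ne
  set N := (ν (closedBall 0 r)).toReal
  have hbound : ∀ f : bergmanSpace u, ∫⁻ z, ‖holo f z‖ₑ ^ 2 ∂ν ≤
      ENNReal.ofReal ((M ^ 2 * N + 1) * ‖f‖ ^ 2) := by
    intro f
    rw [← lintegral_add_compl _ (measurableSet_closedBall (x := (0 : ℂ)) (ε := r)), add_mul,
      ENNReal.ofReal_add (by positivity) (by positivity)]
    refine add_le_add ?_ ((hr _ (holo_differentiableOn f)).trans (le_of_eq ?_))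
    · calc _ ≤ ∫⁻ _ in closedBall 0 r, ENNReal.ofReal ((M * ‖f‖) ^ 2) ∂ν := by
            refine setLIntegral_mono' measurableSet_closedBall fun z hz => ?_
            rw [← ofReal_norm, ← ENNReal.ofReal_pow (norm_nonneg _)]
            have := hM f z hz
            gcongr
        _ = _ := by
            rw [setLIntegral_const, ← ENNReal.ofReal_toReal hN,
              ← ENNReal.ofReal_mul (by positivity)]
            congr 1; ring
    · rw [← enorm_sq_eq, ENNReal.ofReal_one, one_mul, one_mul, ENNReal.ofReal_pow (norm_nonneg _),
        ofReal_norm]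
  have hmem : ∀ f : bergmanSpace u, MemLp (holo f) 2 ν := fun f =>
    memLp_two_of_differentiableOn hν (holo_differentiableOn f)
      ((hbound f).trans_lt ENNReal.ofReal_lt_top)
  have hd : ∀ᵐ z ∂ν, z ∈ disc := hν
  refine ⟨LinearMap.mkContinuous
    { toFun := fun f => (hmem f).toLp (holo f)
      map_add' := fun f g => by
        rw [← MemLp.toLp_add]
        exact MemLp.toLp_congr _ _ (hd.mono fun z hz => holo_add hu f g hz)
      map_smul' := fun c f => by
        rw [RingHom.id_apply, ← MemLp.toLp_const_smul]
        exact MemLp.toLp_congr _ _ (hd.mono fun z hz => holo_smul hu c f hz) }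
    (√(M ^ 2 * N + 1)) fun f => ?_, fun f => (hmem f).coeFn_toLp⟩
  have h1 : ‖(hmem f).toLp (holo f)‖ₑ ^ 2 ≤ ENNReal.ofReal ((M ^ 2 * N + 1) * ‖f‖ ^ 2) := by
    rw [Lp.enorm_toLp, eLpNorm_two_sq]
    exact hbound f
  have h2 := enorm_sq_le_ofReal (by positivity) h1
  refine le_of_sq_le_sq ?_ (by positivity)
  rw [mul_pow, Real.sq_sqrt (by positivity)]
  exact h2

/-- By equicontinuity, the values at a finite net control `f` on a smaller closed disc up to `η
‖f‖`, and the tail costs `(ε / 2) ‖f‖`. The inclusion is therefore dominated by a finite-rank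
evaluation map up to `ε ‖f‖`. -/
theorem VanishingTails.isVanishingCarleson (hu : IsB2Weight u) (hν : ν discᶜ = 0)
    (h : VanishingTails u ν) : IsVanishingCarleson u ν := by
  obtain ⟨i, hi⟩ := exists_inclusion hu hν h
  refine ⟨i, hi, isCompactOperator_of_norm_le i fun ε hε => ?_⟩
  obtain ⟨hfin, htail⟩ := h
  obtain ⟨r, hr1, hr⟩ := htail ((ε / 2) ^ 2) (by positivity)
  have hNtop := (hfin r hr1).ne
  set N := (ν (closedBall 0 r)).toReal
  have hN0 : 0 ≤ N := ENNReal.toReal_nonneg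
  -- Chosen so that `√N η ≤ ε / 2`; the summand 1 covers `N = 0`.
  set η := ε / (2 * (√N + 1)) with hη
  have hη0 : 0 < η := by positivity
  obtain ⟨ρ, hρ0, hρ⟩ := exists_norm_holo_sub_le hu hr1 hη0
  obtain ⟨t, hts, htf, hcov⟩ := totallyBounded_iff_subset.1
    (isCompact_closedBall (0 : ℂ) r).totallyBounded _ (Metric.dist_mem_uniformity hρ0)
  obtain ⟨n, p, hp⟩ : ∃ (n : ℕ) (p : Fin n → ℂ), Set.range p = t := by
    obtain ⟨n, p, -, hp⟩ := htf.fin_param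
    exact ⟨n, p, hp⟩
  have hpc : ∀ k, p k ∈ closedBall (0 : ℂ) r := fun k => hts (hp ▸ Set.mem_range_self k)
  have hpd : ∀ k, p k ∈ disc := fun k => closedBall_subset_ball hr1 (hpc k)
  set T : bergmanSpace u →L[ℂ] (Fin n → ℂ) :=
    ContinuousLinearMap.pi fun k => evalCLM hu (hpd k) with hT
  refine ⟨n, ((√N : ℝ) : ℂ) • T, fun f => ?_⟩
  have hpt : ∀ z ∈ closedBall (0 : ℂ) r, ‖holo f z‖ ≤ ‖T f‖ + η * ‖f‖ := by
    intro z hz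
    obtain ⟨y, hy, hzy⟩ := Set.mem_iUnion₂.1 (hcov hz)
    rw [← hp] at hy
    obtain ⟨k, rfl⟩ := hy
    have h1 := hρ f (p k) (hpc k) z hzy
    have h2 : ‖holo f (p k)‖ ≤ ‖T f‖ := norm_le_pi_norm (T f) k
    have h3 := norm_sub_norm_le (holo f z) (holo f (p k))
    linarith
  have h1 : ‖i f‖ₑ ^ 2 ≤
      ENNReal.ofReal ((‖T f‖ + η * ‖f‖) ^ 2 * N + (ε / 2) ^ 2 * ‖f‖ ^ 2) := by
    rw [Lp.enorm_def, eLpNorm_congr_ae (hi f), eLpNorm_two_sq,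
      ← lintegral_add_compl _ (measurableSet_closedBall (x := (0 : ℂ)) (ε := r)),
      ENNReal.ofReal_add (by positivity) (by positivity)]
    refine add_le_add ?_ ((hr _ (holo_differentiableOn f)).trans (le_of_eq ?_))
    · rw [ENNReal.ofReal_mul (by positivity), ENNReal.ofReal_toReal hNtop, ← setLIntegral_const]
      refine setLIntegral_mono' measurableSet_closedBall fun z hz => ?_
      rw [← ofReal_norm, ← ENNReal.ofReal_pow (norm_nonneg _)]
      have := hpt z hz
      gcongr
    · rw [← enorm_sq_eq, ENNReal.ofReal_mul (by positivity), ENNReal.ofReal_pow (norm_nonneg _),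
        ofReal_norm]
  have h2 := enorm_sq_le_ofReal (by positivity) h1
  have hs : √N ^ 2 = N := Real.sq_sqrt hN0
  have h3 : ‖i f‖ ≤ √N * (‖T f‖ + η * ‖f‖) + ε / 2 * ‖f‖ := by
    refine le_of_sq_le_sq (h2.trans ?_) (by positivity)
    have : 0 ≤ √N * (‖T f‖ + η * ‖f‖) * (ε / 2 * ‖f‖) := by positivity
    nlinarith
  have h4 : √N * η ≤ ε / 2 := by
    rw [hη, ← mul_div_assoc, div_le_iff₀ (by positivity)]
    nlinarith [Real.sqrt_nonneg N]
  rw [smul_apply, norm_smul, Complex.norm_real,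
    Real.norm_of_nonneg (Real.sqrt_nonneg N)]
  have h5 : √N * η * ‖f‖ ≤ ε / 2 * ‖f‖ := by gcongr
  linarith

theorem ToeplitzCompact.mono {E E' : Set (bergmanSpace u)} (hE : E ⊆ E')
    (h : ToeplitzCompact u ν E') : ToeplitzCompact u ν E := by
  obtain ⟨T, hT, hc⟩ := h
  exact ⟨T, fun f hf => hT f (hE hf), hc⟩

end

end BergmanToeplitz

theorem mainTheorem1 (u : ℂ → ℝ) (hu : BergmanToeplitz.IsB2Weight u)
    (ν : Measure ℂ) (hν : ν (BergmanToeplitz.disc)ᶜ = 0) :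
    List.TFAE [
      BergmanToeplitz.ToeplitzCompact u ν
        (BergmanToeplitz.polynomials u ∪ BergmanToeplitz.kernels u),
      BergmanToeplitz.ToeplitzCompact u ν Set.univ,
      Tendsto (BergmanToeplitz.berezin u ν) (comap (fun a : ℂ => ‖a‖) (𝓝[<] 1)) (𝓝 0),
      BergmanToeplitz.IsVanishingCarleson u ν] := by
  tfae_have 1 → 3 := fun h =>
    ((h.mono Set.subset_union_right).vanishingOnCells hu hν |>.vanishingTails hu hν).tendsto_berezin
      hu
  tfae_have 3 → 4 := fun h =>
    ((BergmanToeplitz.vanishingOnCells_of_tendsto_berezin hu hν h).vanishingTails hu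
      hν).isVanishingCarleson hu hν
  tfae_have 4 → 2 := fun h => h.toeplitzCompact hu hν
  tfae_have 2 → 1 := fun h => h.mono (Set.subset_univ _)
  tfae_finish
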